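/- For $w\in\mathbb N$ identify $[2^w]=\{0,\dots,2^w-1\}$ with the set of $w$-bit strings and let $\oplus$ be bitwise exclusive-or, applied coordinatewise to vectors. Let $\Phi$ and $\Psi$ be such sets. Given character tables $h_0,\dots,h_{c-1}:\Phi\to\Psi^d$, the simple tabulation function $h:\Phi^c\to\Psi^d$ is $h(x_0,\dots,x_{c-1})=h_0(x_0)\oplus\cdots\oplus h_{c-1}(x_{c-1})$. A function $f:U\to\Psi^d$ is $k$-unique if for every non-empty $X\subseteq U$ with $|X|\le k$ there are a position $j$, a character $a\in\Psi$ and a key $x\in X$ such that $f(x)_j=a$ and $f(y)_j\ne a$ for all $y\in X\setminus\{x\}$. A random function $g:\Phi\to R$ (with $R$ finite) is $k$-independent if each $g(a)$ is uniformly distributed in $R$ and $g(a_1),\dots,g(a_k)$ are independent for any distinct $a_1,\dots,a_k\in\Phi$; it is fully random if all the values $g(a)$, $a\in\Phi$, are independent and uniform in $R$. Suppose that the random character tables $h_0,\dots,h_{c-1}$ are independent of each other and that each of them is fully random or at least $100$-independent. Then: 1. (32-bit keys) for $\Phi=\Psi=[2^{16}]$, $c=2$, $d=20$, the probability that $h$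 is not $100$-unique is at most $1.5\times10^{-42}$; 2. (64-bit keys) for $\Phi=\Psi=[2^{22}]$, $c=3$, $d=24$, the probability that $h$ is not $100$-unique is at most $1.4\times10^{-49}$; 3. (64-bit keys) for $\Phi=[2^{16}]$, $\Psi=[2^{32}]$, $c=4$, $d=14$, the probability that $h$ is not $100$-unique is at most $9.0\times10^{-36}$. -/

import Mathlib

open MeasureTheory ProbabilityTheory

namespace Tabulation

/-- The set `X` of keys has a unique output position character `(j, a)` under `f : U → Ψ^d`:
exactly one key `x ∈ X` has `f(x)_j = a`. -/
def HasUniqueOutputChar {U Ψ : Type*} {d : ℕ} (f : U → Fin d → Ψ) (X : Finset U) : Prop :=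
  ∃ (j : Fin d) (a : Ψ), ∃ x ∈ X, f x j = a ∧ ∀ y ∈ X, y ≠ x → f y j ≠ a

/-- `f` is `k`-unique: every non-empty set of at most `k` keys has a unique output position
character. -/
def IsKUnique {U Ψ : Type*} {d : ℕ} (k : ℕ) (f : U → Fin d → Ψ) : Prop :=
  ∀ X : Finset U, X.Nonempty → X.card ≤ k → HasUniqueOutputChar f X

/-- The simple tabulation function `Φ^c → Ψ^d` with character tables `h i : Φ → Ψ^d`, where
`Ψ = [2^s]` is the set of `s`-bit strings: `h(x)_j = h_0(x_0)_j ⊕ ⋯ ⊕ h_{c-1}(x_{c-1})_j`. -/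
def simpleTabulation {Φ : Type*} {c d s : ℕ} (h : Fin c → Φ → Fin d → BitVec s) :
    (Fin c → Φ) → Fin d → BitVec s :=
  fun x j => Finset.univ.fold (· ^^^ ·) 0#s (fun i => h i (x i) j)

section Random

variable {Ω : Type*} [MeasurableSpace Ω]

/-- For every fixed key, its hash value is uniformly distributed in the (finite) range `R`. -/
def HasUniformValues {U R : Type*} (μ : Measure Ω) (h : Ω → U → R) : Prop :=
  ∀ (u : U) (r : R), μ {ω | h ω u = r} = (Nat.card R : ENNReal)⁻¹

/-- `k`-independent random function: any `k` distinct keys have independent hash values, and every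
hash value is uniform. The range carries the discrete σ-algebra `⊤`. -/
def IsKIndependent {U R : Type*} (k : ℕ) (μ : Measure Ω) (h : Ω → U → R) : Prop :=
  (∀ x : Fin k → U, Function.Injective x →
    iIndepFun (m := fun _ => (⊤ : MeasurableSpace R)) (fun i ω => h ω (x i)) μ) ∧
  HasUniformValues μ h

/-- Fully random function: the hash values of all keys are independent and uniform. -/
def IsFullyRandom {U R : Type*} (μ : Measure Ω) (h : Ω → U → R) : Prop :=
  iIndepFun (m := fun _ : U => (⊤ : MeasurableSpace R)) (fun u ω => h ω u) μ ∧
  HasUniformValues μ h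

/-- Random character tables `h_0, …, h_{c-1} : Φ → R` (random variables for the discrete
σ-algebra on the set of all tables) that are independent of each other, each of them being fully
random or at least `k`-independent. -/
structure AreRandomTables {Φ R : Type*} {c : ℕ} (k : ℕ) (μ : Measure Ω)
    (h : Fin c → Ω → Φ → R) : Prop where
  measurable : ∀ i, Measurable[_, (⊤ : MeasurableSpace (Φ → R))] (h i)
  indep : iIndepFun (m := fun _ => (⊤ : MeasurableSpace (Φ → R))) h μ
  random : ∀ i, IsFullyRandom μ (h i) ∨ IsKIndependent k μ (h i)

end Random

end Tabulation

/-
If no key of `X` has a unique output character, then in every output position every key of `X`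
collides with another one. A collision of `x` and `y` is a linear relation over `ZMod 2` between the
table entries of the characters in the symmetric difference of `x` and `y`, and relations with
distinct leading characters are independent, so that `r` of them hold with probability `|Ψ| ^ (-r)`.
Averaging over the sets of the characters that occur in at least `g` keys of `X` shows that one of
these sets carries many independent relations for its size, even if the characters in one input
position count more than the others. The weights are chosen by the number of output positions in
which one particular pair of characters of that position agrees: if it is large, then the agreements
alone are unlikely; otherwise, they are the beginning of a family of relations, since the pair is
contained in the chosen set for all weights. A union bound over the possible families of relations
completes the proof.
-/

namespace Tabulation

open Finset
open scoped symmDiff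

/-! ### Bit strings as an elementary abelian 2-group -/

/-- The `s`-bit strings, with bitwise exclusive-or as addition. This is a type synonym because the
addition of `BitVec s` is addition modulo `2 ^ s`. -/
def XorBits (s : ℕ) : Type := BitVec s

namespace XorBits

variable {s : ℕ}

instance : Fintype (XorBits s) := inferInstanceAs (Fintype (BitVec s))

instance : Add (XorBits s) := ⟨BitVec.xor⟩

instance : Zero (XorBits s) := ⟨0#s⟩

instance : Neg (XorBits s) := ⟨id⟩

instance : AddCommGroup (XorBits s) where
  add_assoc := BitVec.xor_assoc
  zero_add _ := BitVec.zero_xor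
  add_zero _ := BitVec.xor_zero
  add_comm := BitVec.xor_comm
  neg_add_cancel _ := BitVec.xor_self
  nsmul := nsmulRec
  zsmul := zsmulRec

instance : Module (ZMod 2) (XorBits s) :=
  AddCommGroup.zmodModule fun x => (two_nsmul x).trans BitVec.xor_self

theorem card_eq : Fintype.card (XorBits s) = 2 ^ s :=
  (Fintype.card_congr (BitVec.equivFin (m := s)).toEquiv).trans (Fintype.card_fin _)

theorem fold_xor_eq_sum {ι : Type*} (T : Finset ι) (f : ι → XorBits s) :
    T.fold (β := BitVec s) (· ^^^ ·) 0#s f = ∑ i ∈ T, f i := by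
  classical
  induction T using Finset.induction_on with
  | empty => rfl
  | insert a T ha ih =>
    rw [sum_insert ha, ← ih]
    exact fold_insert (β := BitVec s) ha

end XorBits

theorem sum_symmDiff_eq_add {A R : Type*} [DecidableEq A] [AddCommGroup R] [Module (ZMod 2) R]
    (K L : Finset A) (f : A → R) : ∑ a ∈ K ∆ L, f a = ∑ a ∈ K, f a + ∑ a ∈ L, f a := by
  have hunion : ∑ a ∈ K ∆ L, f a = ∑ a ∈ K \ L, f a + ∑ a ∈ L \ K, f a :=
    sum_union disjoint_sdiff_sdiff
  rw [hunion, ← sum_inter_add_sum_sdiff K L f, ← sum_inter_add_sum_sdiff L K f, inter_comm L K,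
    add_add_add_comm, ZModModule.add_self, zero_add]

/-! ### Triangular families of linear relations -/

section Triangular

variable {A D R : Type*}

/-- A family of relations `∑ α ∈ e, H α j = 0`, encoded as pairs `(j, e)`, is in echelon form with
respect to the ranking `ρ`: no relation is empty, and relations on the same output position have
different top ranks. -/
def Triangular (ρ : A → ℕ) (E : Finset (D × Finset A)) : Prop :=
  (∀ t ∈ E, t.2.Nonempty) ∧ Set.InjOn (fun t : D × Finset A => (t.1, t.2.sup ρ)) E

theorem Triangular.mono {ρ : A → ℕ} {E E' : Finset (D × Finset A)} (h : Triangular ρ E)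
    (hE : E' ⊆ E) : Triangular ρ E' :=
  ⟨fun t ht => h.1 t (hE ht), h.2.mono (coe_subset.2 hE)⟩

theorem Triangular.exists_extension [DecidableEq (D × Finset A)] {ρ : A → ℕ}
    {P E : Finset (D × Finset A)} (hP : Triangular ρ P) (hE : Triangular ρ E) :
    ∃ F ⊆ E, Disjoint P F ∧ Triangular ρ (P ∪ F) ∧ #E ≤ #P + #F := by
  classical
  let key (t : D × Finset A) : D × ℕ := (t.1, t.2.sup ρ)
  let F : Finset (D × Finset A) := {t ∈ E | key t ∉ P.image key}
  have hFE : F ⊆ E := filter_subset _ _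
  have hdisjoint : Disjoint (P : Set (D × Finset A)) F := Set.disjoint_left.2 fun t htP htF =>
    (mem_filter.1 htF).2 (mem_image_of_mem key htP)
  refine ⟨F, hFE, disjoint_coe.1 hdisjoint, ⟨fun t ht => ?_, ?_⟩, ?_⟩
  · exact (mem_union.1 ht).elim (hP.1 t) fun h => hE.1 t (hFE h)
  · rw [coe_union, Set.injOn_union hdisjoint]
    exact ⟨hP.2, hE.2.mono (coe_subset.2 hFE), fun t ht t' ht' heq =>
      (mem_filter.1 ht').2 (mem_image.2 ⟨t, ht, heq⟩)⟩
  · have hdropped : #{t ∈ E | key t ∈ P.image key} ≤ #P :=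
      (card_le_card_of_injOn key (fun t ht => (mem_filter.1 ht).2)
        (hE.2.mono (coe_subset.2 (filter_subset _ _)))).trans card_image_le
    have := card_filter_add_card_filter_not (s := E) fun t => key t ∈ P.image key
    change #E ≤ #P + #{t ∈ E | key t ∉ P.image key}
    omega

/-- The table `H` satisfies all relations of the family `E`. -/
def Holds [AddCommMonoid R] (H : A → D → R) (E : Finset (D × Finset A)) : Prop :=
  ∀ t ∈ E, ∑ α ∈ t.2, H α t.1 = 0

theorem Holds.mono [AddCommMonoid R] {H : A → D → R} {E E' : Finset (D × Finset A)}
    (h : Holds H E) (hE : E' ⊆ E) : Holds H E' := fun t ht => h t (hE ht)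

theorem sum_single_single_apply [DecidableEq A] [DecidableEq D] [AddCommMonoid R] (e : Finset A)
    (α : A) (i j : D) (z : R) :
    ∑ β ∈ e, (Pi.single α (Pi.single i z) : A → D → R) β j = if α ∈ e ∧ j = i then z else 0 := by
  simp only [Pi.single_apply, ite_apply, Pi.zero_apply, sum_ite_eq', ite_and]

variable [Fintype A] [Fintype D] [AddCommGroup R] [Fintype R]

open Classical in
/-- The tables that vanish outside `S` and satisfy the relations `E`. -/
noncomputable def solutions (R : Type*) [AddCommGroup R] [Fintype R] (S : Finset A)
    (E : Finset (D × Finset A)) : Finset (A → D → R) :=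
  {H | (∀ α ∉ S, H α = 0) ∧ Holds H E}

theorem mem_solutions {S : Finset A} {E : Finset (D × Finset A)} {H : A → D → R} :
    H ∈ solutions R S E ↔ (∀ α ∉ S, H α = 0) ∧ Holds H E := by
  simp only [solutions, mem_filter_univ]

theorem card_solutions_empty_le (S : Finset A) :
    #(solutions R S (∅ : Finset (D × Finset A))) ≤ (Fintype.card R ^ Fintype.card D) ^ #S := by
  classical
  have hsub : solutions R S (∅ : Finset (D × Finset A)) ⊆
      Fintype.piFinset fun α => if α ∈ S then univ else {0} := fun H hH =>
    Fintype.mem_piFinset.2 fun α => by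
      split_ifs with hα
      · exact mem_univ _
      · exact mem_singleton.2 ((mem_solutions.1 hH).1 α hα)
  refine (card_le_card hsub).trans_eq ?_
  simp [Fintype.card_piFinset, apply_ite Finset.card]

-- The top character of the relation whose top rank is largest occurs in no other relation on the
-- same output position, so its value can be shifted freely once that relation is dropped.
theorem Triangular.exists_card_solutions_mul_le (R : Type*) [AddCommGroup R] [Fintype R]
    [DecidableEq (D × Finset A)] {ρ : A → ℕ} {S : Finset A} {E : Finset (D × Finset A)}
    (hE : Triangular ρ E) (hS : ∀ t ∈ E, t.2 ⊆ S) (hne : E.Nonempty) :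
    ∃ t ∈ E, #(solutions R S E) * Fintype.card R ≤ #(solutions R S (E.erase t)) := by
  classical
  obtain ⟨t, ht, hmax⟩ := E.exists_max_image (fun t => t.2.sup ρ) hne
  obtain ⟨α, hα, htop⟩ := exists_mem_eq_sup t.2 (hE.1 t ht) ρ
  have hshift : ∀ t' ∈ E, t' ≠ t → ¬(α ∈ t'.2 ∧ t'.1 = t.1) := fun t' ht' hne' ⟨hα', hj⟩ =>
    hne' (hE.2 ht' ht (Prod.ext hj ((hmax t' ht').antisymm (htop.trans_le (le_sup hα')))))
  let shift (z : R) : A → D → R := Pi.single α (Pi.single t.1 z)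
  refine ⟨t, ht, ?_⟩
  rw [← card_univ, ← card_product]
  refine card_le_card_of_injOn (fun p => p.1 + shift p.2) ?_ ?_
  · rintro ⟨H, z⟩ hp
    obtain ⟨hvanish, hH⟩ := mem_solutions.1 (mem_product.1 hp).1
    refine mem_solutions.2 ⟨fun β hβ => ?_, fun t' ht' => ?_⟩
    · have hβα : β ≠ α := fun h => hβ (h ▸ hS t ht hα)
      simp only [Pi.add_apply, shift, Pi.single_eq_of_ne hβα, add_zero]
      exact hvanish β hβ
    · obtain ⟨hne', ht'⟩ := mem_erase.1 ht'
      simp only [Pi.add_apply, sum_add_distrib, hH t' ht', shift, sum_single_single_apply,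
        if_neg (hshift t' ht' hne'), add_zero]
  · rintro ⟨H, z⟩ hp ⟨H', z'⟩ hp' (heq : H + shift z = H' + shift z')
    have hvalue : ∀ H ∈ solutions R S E, ∀ z, ∑ β ∈ t.2, (H + shift z) β t.1 = z := fun H hH z => by
      simp only [Pi.add_apply, sum_add_distrib, (mem_solutions.1 hH).2 t ht, shift,
        sum_single_single_apply, hα, and_self, if_true, zero_add]
    have hz : z = z' := by
      rw [← hvalue H (mem_product.1 hp).1 z, heq, hvalue H' (mem_product.1 hp').1 z']
    subst hz
    exact Prod.ext (add_right_cancel heq) rfl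

theorem Triangular.card_solutions_mul_pow_le (R : Type*) [AddCommGroup R] [Fintype R]
    {ρ : A → ℕ} {S : Finset A} {E : Finset (D × Finset A)}
    (hE : Triangular ρ E) (hS : ∀ t ∈ E, t.2 ⊆ S) :
    #(solutions R S E) * Fintype.card R ^ #E ≤ (Fintype.card R ^ Fintype.card D) ^ #S := by
  classical
  induction hn : #E generalizing E with
  | zero =>
    rw [card_eq_zero.1 hn, pow_zero, mul_one]
    exact card_solutions_empty_le S
  | succ n ih =>
    obtain ⟨t, ht, hle⟩ := hE.exists_card_solutions_mul_le R hS (card_pos.1 (by omega))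
    calc #(solutions R S E) * Fintype.card R ^ (n + 1)
        = #(solutions R S E) * Fintype.card R * Fintype.card R ^ n := by ring
      _ ≤ #(solutions R S (E.erase t)) * Fintype.card R ^ n := Nat.mul_le_mul_right _ hle
      _ ≤ (Fintype.card R ^ Fintype.card D) ^ #S := ih (hE.mono (erase_subset t E))
          (fun t' h => hS t' (mem_of_mem_erase h)) (by rw [card_erase_of_mem ht, hn]; rfl)

end Triangular

/-! ### The probability that random tables satisfy a family of relations -/

section CharsAt

variable {ι Φ : Type*} [DecidableEq ι]

/-- The characters of `S` in the input position `i`; a position character is encoded as a pair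
`(i, a)`. -/
def charsAt (S : Finset (ι × Φ)) (i : ι) : Finset (ι × Φ) := {α ∈ S | α.1 = i}

theorem mem_charsAt {S : Finset (ι × Φ)} {i : ι} {α : ι × Φ} :
    α ∈ charsAt S i ↔ α ∈ S ∧ α.1 = i := mem_filter

theorem charsAt_mono {S T : Finset (ι × Φ)} (h : S ⊆ T) (i : ι) : charsAt S i ⊆ charsAt T i :=
  filter_subset_filter _ h

theorem sum_card_charsAt [Fintype ι] (S : Finset (ι × Φ)) : ∑ i, #(charsAt S i) = #S :=
  (card_eq_sum_card_fiberwise fun _ _ => mem_coe.2 (mem_univ _)).symm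

end CharsAt

section Certified

variable {ι Φ D R : Type*} [DecidableEq ι] [DecidableEq Φ] {k : ℕ}

/-- A family of relations that is in echelon form for some ranking and involves at most `k`
characters of each position, so that it is governed by `k`-independence. -/
structure IsEchelon (k : ℕ) (E : Finset (D × Finset (ι × Φ))) : Prop where
  triangular : ∃ ρ, Triangular ρ E
  card_charsAt_le : ∀ i, #(charsAt (E.sup Prod.snd) i) ≤ k

theorem Triangular.isEchelon {ρ : ι × Φ → ℕ} {E : Finset (D × Finset (ι × Φ))}
    (hE : Triangular ρ E) {S : Finset (ι × Φ)} (hS : ∀ t ∈ E, t.2 ⊆ S)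
    (hk : ∀ i, #(charsAt S i) ≤ k) : IsEchelon k E :=
  ⟨⟨ρ, hE⟩, fun i => (card_le_card (charsAt_mono (Finset.sup_le hS) i)).trans (hk i)⟩

/-- Some family of `r` independent relations in the collection `C` of candidates is satisfied by the
tables `H`. -/
def Certified [AddCommMonoid R] (k : ℕ) (H : ι × Φ → D → R)
    (C : Finset (Finset (D × Finset (ι × Φ)))) (r : ℕ) : Prop :=
  ∃ E ∈ C, #E = r ∧ IsEchelon k E ∧ Holds H E

end Certified

section Law

variable {Ω : Type*} [MeasurableSpace Ω] {μ : Measure Ω}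

theorem measure_forall_eq_of_iIndepFun {ι R : Type*} {g : ι → Ω → R}
    (hg : iIndepFun (m := fun _ => (⊤ : MeasurableSpace R)) g μ) (T : Finset ι) (f : ι → R) :
    μ {ω | ∀ i ∈ T, g i ω = f i} = ∏ i ∈ T, μ {ω | g i ω = f i} := by
  have hinter : {ω | ∀ i ∈ T, g i ω = f i} = ⋂ i ∈ T, g i ⁻¹' {f i} := by ext; simp
  rw [hinter]
  exact hg.measure_inter_preimage_eq_mul T fun _ _ => MeasurableSpace.measurableSet_top

theorem iIndepFun_restrict_of_card_le {U R : Type*} [Fintype U] {k : ℕ}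
    (hk : k ≤ Fintype.card U) {h : Ω → U → R} (hh : IsFullyRandom μ h ∨ IsKIndependent k μ h)
    {T : Finset U} (hT : #T ≤ k) :
    iIndepFun (m := fun _ => (⊤ : MeasurableSpace R)) (fun (u : T) ω => h ω u) μ := by
  rcases hh with hh | hh
  · exact hh.1.precomp Subtype.val_injective
  · obtain ⟨T', hTT', hT'⟩ := exists_superset_card_eq hT hk
    let e : T' ≃ Fin k := T'.equivFinOfCardEq hT'
    have hindep := hh.1 (fun i => e.symm i) (Subtype.val_injective.comp e.symm.injective)
    let inclusion (u : T) : T' := ⟨u, hTT' u.2⟩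
    have hinj : inclusion.Injective := fun u v huv =>
      Subtype.ext (congrArg (fun w : T' => (w : U)) huv)
    simpa [Function.comp_def, inclusion] using hindep.precomp (e.injective.comp hinj)

theorem measure_table_eq {U R : Type*} [Fintype U] {k : ℕ} (hk : k ≤ Fintype.card U)
    {h : Ω → U → R} (hh : IsFullyRandom μ h ∨ IsKIndependent k μ h) {T : Finset U} (hT : #T ≤ k)
    (f : U → R) : μ {ω | ∀ u ∈ T, h ω u = f u} = (Nat.card R : ENNReal)⁻¹ ^ #T := by
  have huniform : HasUniformValues μ h := hh.elim And.right And.right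
  have hmeasure := measure_forall_eq_of_iIndepFun (iIndepFun_restrict_of_card_le hk hh hT) univ
    fun u => f u
  simpa [huniform _ _] using hmeasure

theorem AreRandomTables.measure_forall_eq {Φ R : Type*} [Fintype Φ] {c k : ℕ}
    {h : Fin c → Ω → Φ → R} (hh : AreRandomTables k μ h) (hk : k ≤ Fintype.card Φ)
    {S : Finset (Fin c × Φ)} (hS : ∀ i, #(charsAt S i) ≤ k) (f : Fin c × Φ → R) :
    μ {ω | ∀ α ∈ S, h α.1 ω α.2 = f α} = (Nat.card R : ENNReal)⁻¹ ^ #S := by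
  classical
  let T (i : Fin c) : Finset Φ := {u | (i, u) ∈ S}
  have hT (i : Fin c) : #(T i) = #(charsAt S i) := by
    refine card_nbij (Prod.mk i) (fun u hu => ?_) (Prod.mk_right_injective i).injOn ?_
    · exact mem_charsAt.2 ⟨(mem_filter_univ u).1 hu, rfl⟩
    · rintro α hα
      obtain ⟨hαS, rfl⟩ := mem_charsAt.1 hα
      exact ⟨α.2, (mem_filter_univ _).2 hαS, rfl⟩
  have hinter : {ω | ∀ α ∈ S, h α.1 ω α.2 = f α}
      = ⋂ i ∈ univ, h i ⁻¹' {t | ∀ u ∈ T i, t u = f (i, u)} := by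
    ext; simp [T]
  calc μ {ω | ∀ α ∈ S, h α.1 ω α.2 = f α}
      = ∏ i, μ (h i ⁻¹' {t | ∀ u ∈ T i, t u = f (i, u)}) := by
        rw [hinter]
        exact hh.indep.measure_inter_preimage_eq_mul univ
          fun _ _ => MeasurableSpace.measurableSet_top
    _ = ∏ i, (Nat.card R : ENNReal)⁻¹ ^ #(charsAt S i) := by
        refine prod_congr rfl fun i _ => ?_
        rw [← hT i]
        exact measure_table_eq hk (hh.random i) ((hT i).trans_le (hS i)) fun u => f (i, u)
    _ = (Nat.card R : ENNReal)⁻¹ ^ #S := by rw [prod_pow_eq_pow_sum, sum_card_charsAt]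

section Group

variable {Φ D R : Type*} [DecidableEq Φ] {c k : ℕ}

variable [Fintype Φ] [Finite D] [AddCommGroup R] [Fintype R]

theorem AreRandomTables.measure_holds_le {h : Fin c → Ω → Φ → D → R}
    (hh : AreRandomTables k μ h) (hk : k ≤ Fintype.card Φ)
    {E : Finset (D × Finset (Fin c × Φ))} (hE : IsEchelon k E) :
    μ {ω | Holds (fun α => h α.1 ω α.2) E} ≤ (Fintype.card R : ENNReal)⁻¹ ^ #E := by
  classical
  cases nonempty_fintype D
  obtain ⟨ρ, hρ⟩ := hE.triangular
  set S := E.sup Prod.snd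
  have hES : ∀ t ∈ E, t.2 ⊆ S := fun t ht => le_sup (f := Prod.snd) ht
  have hcover : {ω | Holds (fun α => h α.1 ω α.2) E} ⊆
      ⋃ f ∈ solutions R S E, {ω | ∀ α ∈ S, h α.1 ω α.2 = f α} := fun ω hω => by
    refine Set.mem_biUnion (x := fun α => if α ∈ S then h α.1 ω α.2 else 0)
      (mem_solutions.2 ⟨fun α hα => if_neg hα, fun t ht => ?_⟩) fun α hα => (if_pos hα).symm
    exact (sum_congr rfl fun α hα => congrFun (if_pos (hES t ht hα)) t.1).trans (hω t ht)
  have hsolutions : (#(solutions R S E) : ENNReal) * Fintype.card R ^ #E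
      ≤ (Nat.card (D → R) : ENNReal) ^ #S := by
    rw [Nat.card_eq_fintype_card, Fintype.card_fun]
    exact_mod_cast hρ.card_solutions_mul_pow_le R hES
  calc μ {ω | Holds (fun α => h α.1 ω α.2) E}
      ≤ ∑ f ∈ solutions R S E, μ {ω | ∀ α ∈ S, h α.1 ω α.2 = f α} :=
        (measure_mono hcover).trans (measure_biUnion_finset_le _ _)
    _ = #(solutions R S E) / (Nat.card (D → R) : ENNReal) ^ #S := by
        rw [sum_congr rfl fun f _ => hh.measure_forall_eq hk hE.card_charsAt_le f, sum_const,
          nsmul_eq_mul, ← ENNReal.inv_pow, div_eq_mul_inv]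
    _ ≤ (Fintype.card R : ENNReal)⁻¹ ^ #E := by
        rw [← ENNReal.inv_pow]
        refine ENNReal.div_le_of_le_mul ?_
        rw [mul_comm, ← div_eq_mul_inv]
        refine (ENNReal.le_div_iff_mul_le (.inl ?_) (.inl ?_)).2 hsolutions
        · exact pow_ne_zero _ (Nat.cast_ne_zero.2 Fintype.card_ne_zero)
        · exact ENNReal.pow_ne_top (ENNReal.natCast_ne_top _)

theorem AreRandomTables.measure_certified_le {h : Fin c → Ω → Φ → D → R}
    (hh : AreRandomTables k μ h) (hk : k ≤ Fintype.card Φ)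
    (C : Finset (Finset (D × Finset (Fin c × Φ)))) (r : ℕ) :
    μ {ω | Certified k (fun α => h α.1 ω α.2) C r} ≤ #C * (Fintype.card R : ENNReal)⁻¹ ^ r := by
  classical
  let C' : Finset (Finset (D × Finset (Fin c × Φ))) := {E ∈ C | #E = r ∧ IsEchelon k E}
  have hcover : {ω | Certified k (fun α => h α.1 ω α.2) C r} ⊆
      ⋃ E ∈ C', {ω | Holds (fun α => h α.1 ω α.2) E} := fun ω ⟨E, hEC, hr, hE, hω⟩ =>
    Set.mem_biUnion (mem_coe.2 (mem_filter.2 ⟨hEC, hr, hE⟩)) hω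
  calc μ {ω | Certified k (fun α => h α.1 ω α.2) C r}
      ≤ ∑ E ∈ C', μ {ω | Holds (fun α => h α.1 ω α.2) E} :=
        (measure_mono hcover).trans (measure_biUnion_finset_le _ _)
    _ ≤ ∑ _ ∈ C', (Fintype.card R : ENNReal)⁻¹ ^ r := sum_le_sum fun E hE => by
        obtain ⟨-, hr, hE⟩ := mem_filter.1 hE
        exact hr ▸ hh.measure_holds_le hk hE
    _ ≤ #C * (Fintype.card R : ENNReal)⁻¹ ^ r := by
        rw [sum_const, nsmul_eq_mul]
        gcongr
        exact filter_subset _ _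

end Group

end Law

/-! ### Relations forced by a set of keys without a unique output character -/

theorem card_le_two_mul_card_filter {U B : Type*} {X : Finset U} {f : U → B} {P : U → Prop}
    [DecidablePred P] (hpartner : ∀ x ∈ X, ∃ y ∈ X, y ≠ x ∧ f y = f x)
    (hpair : ∀ x ∈ X, ∀ y ∈ X, x ≠ y → f x = f y → P x ∨ P y) : #X ≤ 2 * #{x ∈ X | P x} := by
  choose! partner hmem hne heq using hpartner
  have hcard : #{x ∈ X | ¬P x} ≤ #{x ∈ X | P x} := by
    refine card_le_card_of_injOn partner (fun x hx => ?_) fun x hx y hy hxy => ?_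
    · obtain ⟨hx, hPx⟩ := mem_filter.1 hx
      exact mem_filter.2 ⟨hmem x hx, (hpair _ (hmem x hx) x hx (hne x hx) (heq x hx)).resolve_right
        hPx⟩
    · obtain ⟨hx, hPx⟩ := mem_filter.1 hx
      obtain ⟨hy, hPy⟩ := mem_filter.1 hy
      by_contra hxy'
      have hf : f x = f y := by rw [← heq x hx, hxy, heq y hy]
      exact (hpair x hx y hy hxy' hf).elim hPx hPy
  rw [← card_filter_add_card_filter_not (s := X) P, two_mul]
  exact Nat.add_le_add_left hcard _

theorem exists_injective_rank {A : Type*} [Finite A] (f : A → ℕ) :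
    ∃ ρ : A → ℕ, ρ.Injective ∧ ∀ a b, f a < f b → ρ a < ρ b := by
  obtain ⟨n, ⟨e⟩⟩ := Finite.exists_equiv_fin A
  refine ⟨fun a => f a * n + e a, fun a b hab => ?_, fun a b hab => ?_⟩
  · have hmod : (e a : ℕ) % n = e b % n := by simpa using congrArg (· % n) hab
    rw [Nat.mod_eq_of_lt (e a).2, Nat.mod_eq_of_lt (e b).2] at hmod
    exact e.injective (Fin.ext hmod)
  · calc f a * n + e a < (f a + 1) * n := by rw [add_one_mul]; exact Nat.add_lt_add_left (e a).2 _
      _ ≤ f b * n := Nat.mul_le_mul_right n hab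
      _ ≤ f b * n + e b := Nat.le_add_right _ _

theorem exists_collision_of_not_hasUniqueOutputChar {U Ψ : Type*} {d : ℕ} {f : U → Fin d → Ψ}
    {X : Finset U} (hX : ¬HasUniqueOutputChar f X) (j : Fin d) :
    ∀ x ∈ X, ∃ y ∈ X, y ≠ x ∧ f y j = f x j := by
  intro x hx
  by_contra! hne
  exact hX ⟨j, f x j, x, hx, rfl, hne⟩

section Keys

variable {ι Φ D R : Type*} [Fintype ι] [DecidableEq ι] [DecidableEq Φ]

/-- The set of position characters of a key. -/
def keySet (x : ι → Φ) : Finset (ι × Φ) := univ.image fun i => (i, x i)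

theorem mem_keySet {x : ι → Φ} {α : ι × Φ} : α ∈ keySet x ↔ x α.1 = α.2 := by
  simp [keySet, Prod.ext_iff]

theorem mk_mem_keySet (x : ι → Φ) (i : ι) : (i, x i) ∈ keySet x := mem_keySet.2 rfl

/-- The hash value in position `j` of the key `x` under simple tabulation with the tables `H`. -/
def hashSum [AddCommMonoid R] (H : ι × Φ → D → R) (x : ι → Φ) (j : D) : R := ∑ i, H (i, x i) j

theorem sum_keySet [AddCommMonoid R] (H : ι × Φ → D → R) (x : ι → Φ) (j : D) :
    ∑ α ∈ keySet x, H α j = hashSum H x j :=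
  sum_image fun _ _ _ _ h => congrArg Prod.fst h

theorem exists_pair_mem_symmDiff_keySet {x y : ι → Φ} (h : x ≠ y) :
    ∃ α β, α ≠ β ∧ α.1 = β.1 ∧ α ∈ keySet x ∆ keySet y ∧ β ∈ keySet x ∆ keySet y := by
  obtain ⟨i, hi⟩ := Function.ne_iff.1 h
  refine ⟨(i, x i), (i, y i), fun h => hi (congrArg Prod.snd h), rfl, ?_, ?_⟩
  · exact mem_symmDiff.2 (.inl ⟨mk_mem_keySet x i, fun h => hi (mem_keySet.1 h).symm⟩)
  · exact mem_symmDiff.2 (.inr ⟨mk_mem_keySet y i, fun h => hi (mem_keySet.1 h)⟩)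

theorem card_charsAt_keySet_symmDiff (x y : ι → Φ) (i : ι) :
    #(charsAt (keySet x ∆ keySet y) i) = 0 ∨ #(charsAt (keySet x ∆ keySet y) i) = 2 := by
  have hmem (α : ι × Φ) : α ∈ charsAt (keySet x ∆ keySet y) i ↔
      α.1 = i ∧ (x i = α.2 ∧ y i ≠ α.2 ∨ y i = α.2 ∧ x i ≠ α.2) := by
    rw [mem_charsAt, mem_symmDiff, mem_keySet, mem_keySet]
    grind
  by_cases h : x i = y i
  · refine .inl (card_eq_zero.2 (eq_empty_of_forall_notMem fun α hα => ?_))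
    grind
  · have hpair : charsAt (keySet x ∆ keySet y) i = {(i, x i), (i, y i)} := by
      ext α
      rw [hmem, mem_insert, mem_singleton, Prod.ext_iff, Prod.ext_iff]
      grind
    rw [hpair]
    exact .inr (card_pair fun h' => h (congrArg Prod.snd h'))

section Deg

/-- The number of keys of `X` that contain the position character `α`. -/
def deg (X : Finset (ι → Φ)) (α : ι × Φ) : ℕ := #{x ∈ X | α ∈ keySet x}

theorem deg_le_card (X : Finset (ι → Φ)) (α : ι × Φ) : deg X α ≤ #X := card_filter_le _ _

variable [Fintype Φ]

/-- The position characters that are contained in at least `g` keys of `X`. -/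
def level (X : Finset (ι → Φ)) (g : ℕ) : Finset (ι × Φ) := {α | g ≤ deg X α}

theorem mem_level {X : Finset (ι → Φ)} {g : ℕ} {α : ι × Φ} : α ∈ level X g ↔ g ≤ deg X α :=
  mem_filter_univ α

theorem sum_deg_position (X : Finset (ι → Φ)) (i : ι) : ∑ α ∈ charsAt univ i, deg X α = #X := by
  rw [card_eq_sum_card_fiberwise (f := fun x => (i, x i)) (t := charsAt univ i)
    fun x _ => mem_charsAt.2 ⟨mem_univ _, rfl⟩]
  refine sum_congr rfl fun α hα => congrArg card (filter_congr fun x _ => ?_)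
  obtain ⟨-, rfl⟩ := mem_charsAt.1 hα
  rw [mem_keySet, Prod.ext_iff, and_iff_right rfl]

theorem sum_card_charsAt_level (X : Finset (ι → Φ)) (i : ι) :
    ∑ g ∈ Icc 1 #X, #(charsAt (level X g) i) = #X := by
  have hcount (α : ι × Φ) : #{g ∈ Icc 1 #X | α ∈ level X g} = deg X α := by
    have hIcc : {g ∈ Icc 1 #X | α ∈ level X g} = Icc 1 (deg X α) := by
      ext g
      have := deg_le_card X α
      simp only [mem_filter, mem_Icc, mem_level]
      omega
    rw [hIcc, Nat.card_Icc, Nat.add_sub_cancel]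
  have hcharsAt (g : ℕ) : charsAt (level X g) i =
      {α ∈ charsAt (Φ := Φ) univ i | α ∈ level X g} := by
    ext; simp [mem_charsAt, and_comm]
  calc ∑ g ∈ Icc 1 #X, #(charsAt (level X g) i)
      = ∑ g ∈ Icc 1 #X, #{α ∈ charsAt univ i | α ∈ level X g} := by simp_rw [hcharsAt]
    _ = ∑ α ∈ charsAt univ i, #{g ∈ Icc 1 #X | α ∈ level X g} :=
        (sum_card_bipartiteAbove_eq_sum_card_bipartiteBelow fun (α : ι × Φ) g => α ∈ level X g).symm
    _ = #X := by rw [sum_congr rfl fun α _ => hcount α, sum_deg_position]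

theorem sum_card_level_sdiff_charsAt (X : Finset (ι → Φ)) (i : ι) :
    ∑ g ∈ Icc 1 #X, #(level X g \ charsAt (level X g) i) = (Fintype.card ι - 1) * #X := by
  have hlevel : ∑ g ∈ Icc 1 #X, #(level X g) = Fintype.card ι * #X :=
    calc ∑ g ∈ Icc 1 #X, #(level X g) = ∑ g ∈ Icc 1 #X, ∑ i, #(charsAt (level X g) i) :=
          sum_congr rfl fun g _ => (sum_card_charsAt _).symm
      _ = ∑ _i : ι, #X := by rw [sum_comm, sum_congr rfl fun i _ => sum_card_charsAt_level X i]
      _ = Fintype.card ι * #X := by rw [sum_const, smul_eq_mul, card_univ]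
  have hadd : ∑ g ∈ Icc 1 #X, #(level X g \ charsAt (level X g) i) + #X = Fintype.card ι * #X :=
    calc ∑ g ∈ Icc 1 #X, #(level X g \ charsAt (level X g) i) + #X
        = ∑ g ∈ Icc 1 #X, (#(level X g \ charsAt (level X g) i) + #(charsAt (level X g) i)) := by
          rw [sum_add_distrib, sum_card_charsAt_level]
      _ = ∑ g ∈ Icc 1 #X, #(level X g) :=
          sum_congr rfl fun g _ => card_sdiff_add_card_eq_card (filter_subset _ _)
      _ = Fintype.card ι * #X := hlevel
  rw [Nat.sub_mul, one_mul, ← hadd, Nat.add_sub_cancel]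

theorem card_charsAt_level_le (X : Finset (ι → Φ)) {g : ℕ} (hg : 1 ≤ g) (i : ι) :
    #(charsAt (level X g) i) ≤ #X := by
  rw [← sum_deg_position X i, card_eq_sum_ones]
  refine (sum_le_sum fun α hα => hg.trans (mem_level.1 (mem_charsAt.1 hα).1)).trans
    (sum_le_sum_of_subset (charsAt_mono (subset_univ _) i))

theorem keySet_subset_level_one {X : Finset (ι → Φ)} {x : ι → Φ} (hx : x ∈ X) :
    keySet x ⊆ level X 1 := fun _ hα =>
  mem_level.2 (card_pos.2 ⟨x, mem_filter.2 ⟨hx, hα⟩⟩)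

theorem subset_level_of_sup_le {X : Finset (ι → Φ)} {ρ : ι × Φ → ℕ}
    (hρ : ∀ α β, deg X β < deg X α → ρ α < ρ β) {e e' : Finset (ι × Φ)} (he : e.Nonempty)
    (hle : e'.sup ρ ≤ e.sup ρ) {g : ℕ} (hg : e ⊆ level X g) : e' ⊆ level X g := by
  intro β hβ
  obtain ⟨α, hα, htop⟩ := exists_mem_eq_sup e he ρ
  by_contra hβg
  have hdeg : deg X β < deg X α :=
    (not_le.1 (mt mem_level.2 hβg)).trans_le (mem_level.1 (hg hα))
  have hβα : ρ β ≤ ρ α := (le_sup hβ).trans (hle.trans_eq htop)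
  exact (hρ α β hdeg).not_ge hβα

end Deg

section Collisions

/-- A ranking of the position characters by decreasing number of keys of `X` that contain them. -/
structure IsDegRank (X : Finset (ι → Φ)) (ρ : ι × Φ → ℕ) : Prop where
  injective : ρ.Injective
  lt_of_deg_lt : ∀ α β, deg X β < deg X α → ρ α < ρ β

theorem exists_isDegRank [Finite Φ] (X : Finset (ι → Φ)) : ∃ ρ : ι × Φ → ℕ, IsDegRank X ρ := by
  obtain ⟨ρ, hinj, hlt⟩ := exists_injective_rank fun α : ι × Φ => #X - deg X α
  refine ⟨ρ, hinj, fun α β h => hlt α β ?_⟩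
  have := deg_le_card X α
  omega

variable [Fintype Φ]

theorem IsDegRank.card_hit_le {X : Finset (ι → Φ)} {ρ : ι × Φ → ℕ} (hρ : IsDegRank X ρ)
    {e : Finset (ι × Φ)} (he : e.Nonempty) :
    #{x ∈ X | ∃ α ∈ e, ρ α = e.sup ρ ∧ α ∈ keySet x} ≤ #{g ∈ Icc 1 #X | e ⊆ level X g} := by
  obtain ⟨α, -, htop⟩ := exists_mem_eq_sup e he ρ
  have hlevel : Icc 1 (deg X α) ⊆ {g ∈ Icc 1 #X | e ⊆ level X g} := fun g hg => by
    obtain ⟨hg, hgα⟩ := mem_Icc.1 hg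
    refine mem_filter.2 ⟨mem_Icc.2 ⟨hg, hgα.trans (deg_le_card X α)⟩, ?_⟩
    exact subset_level_of_sup_le hρ.lt_of_deg_lt (singleton_nonempty α)
      (htop.trans_le sup_singleton.ge) (singleton_subset_iff.2 (mem_level.2 hgα))
  calc #{x ∈ X | ∃ α ∈ e, ρ α = e.sup ρ ∧ α ∈ keySet x}
      ≤ #{x ∈ X | α ∈ keySet x} := by
        refine card_le_card (monotone_filter_right X fun x _ => ?_)
        rintro ⟨β, -, hβ, hx⟩
        rwa [hρ.injective (htop.symm.trans hβ.symm)]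
    _ = #(Icc 1 (deg X α)) := by rw [Nat.card_Icc, Nat.add_sub_cancel, deg]
    _ ≤ #{g ∈ Icc 1 #X | e ⊆ level X g} := card_le_card hlevel

variable [Fintype D]

open Classical in
/-- The relations, encoded as in `Triangular`, which state that two different keys of `X` collide in
an output position where they do collide under the tables `H`. -/
noncomputable def collisions [AddCommMonoid R] (H : ι × Φ → D → R) (X : Finset (ι → Φ)) :
    Finset (D × Finset (ι × Φ)) :=
  {t | ∃ x ∈ X, ∃ y ∈ X, x ≠ y ∧ hashSum H x t.1 = hashSum H y t.1 ∧ t.2 = keySet x ∆ keySet y}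

theorem mem_collisions [AddCommMonoid R] {H : ι × Φ → D → R} {X : Finset (ι → Φ)}
    {t : D × Finset (ι × Φ)} : t ∈ collisions H X ↔ ∃ x ∈ X, ∃ y ∈ X, x ≠ y ∧
      hashSum H x t.1 = hashSum H y t.1 ∧ t.2 = keySet x ∆ keySet y := by
  simp only [collisions, mem_filter_univ]

theorem holds_collisions [AddCommGroup R] [Module (ZMod 2) R] (H : ι × Φ → D → R)
    (X : Finset (ι → Φ)) : Holds H (collisions H X) := fun t ht => by
  obtain ⟨x, -, y, -, -, heq, ht⟩ := mem_collisions.1 ht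
  rw [ht, sum_symmDiff_eq_add, sum_keySet, sum_keySet, heq, ZModModule.add_self]

theorem exists_pair_of_mem_collisions [AddCommMonoid R] {H : ι × Φ → D → R} {X : Finset (ι → Φ)}
    {t : D × Finset (ι × Φ)} (ht : t ∈ collisions H X) :
    ∃ α β, α ≠ β ∧ α.1 = β.1 ∧ α ∈ t.2 ∧ β ∈ t.2 := by
  obtain ⟨x, -, y, -, hxy, -, ht⟩ := mem_collisions.1 ht
  exact ht ▸ exists_pair_mem_symmDiff_keySet hxy

theorem nonempty_of_mem_collisions [AddCommMonoid R] {H : ι × Φ → D → R} {X : Finset (ι → Φ)}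
    {t : D × Finset (ι × Φ)} (ht : t ∈ collisions H X) : t.2.Nonempty :=
  let ⟨α, _, _, _, hα, _⟩ := exists_pair_of_mem_collisions ht
  ⟨α, hα⟩

/-- A choice of one of the relations `collisions H X` for every pair of an output position and a top
rank that occurs among them. -/
structure IsPivotFamily [AddCommMonoid R] (H : ι × Φ → D → R) (X : Finset (ι → Φ))
    (ρ : ι × Φ → ℕ) (E : Finset (D × Finset (ι × Φ))) : Prop where
  subset : E ⊆ collisions H X
  injOn : Set.InjOn (fun t : D × Finset (ι × Φ) => (t.1, t.2.sup ρ)) E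
  exists_mem : ∀ t ∈ collisions H X, ∃ t' ∈ E, t'.1 = t.1 ∧ t'.2.sup ρ = t.2.sup ρ

theorem exists_isPivotFamily [AddCommMonoid R] (H : ι × Φ → D → R) (X : Finset (ι → Φ))
    (ρ : ι × Φ → ℕ) : ∃ E, IsPivotFamily H X ρ E := by
  classical
  let key (t : D × Finset (ι × Φ)) : D × ℕ := (t.1, t.2.sup ρ)
  obtain ⟨E, hE, hinj, himage⟩ := exists_subset_injOn_image_eq_of_surjOn (collisions H X)
    ((collisions H X).image key) (f := key) (by rw [coe_image]; exact Set.surjOn_image _ _)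
  refine ⟨E, coe_subset.1 hE, hinj, fun t ht => ?_⟩
  obtain ⟨t', ht', hkey⟩ := mem_image.1 (himage ▸ mem_image_of_mem key ht)
  exact ⟨t', ht', (Prod.ext_iff.1 hkey).1, (Prod.ext_iff.1 hkey).2⟩

theorem IsPivotFamily.triangular [AddCommMonoid R] {H : ι × Φ → D → R} {X : Finset (ι → Φ)}
    {ρ : ι × Φ → ℕ} {E : Finset (D × Finset (ι × Φ))} (hE : IsPivotFamily H X ρ E) :
    Triangular ρ E :=
  ⟨fun _ ht => nonempty_of_mem_collisions (hE.subset ht), hE.injOn⟩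

-- The top characters of the pivots in position `j` hit one key of every colliding pair.
theorem IsPivotFamily.card_le_two_mul_sum [AddCommMonoid R] [DecidableEq D] {H : ι × Φ → D → R}
    {X : Finset (ι → Φ)} {ρ : ι × Φ → ℕ} {E : Finset (D × Finset (ι × Φ))}
    (hE : IsPivotFamily H X ρ E) (hρ : IsDegRank X ρ) {j : D}
    (hX : ∀ x ∈ X, ∃ y ∈ X, y ≠ x ∧ hashSum H y j = hashSum H x j) :
    #X ≤ 2 * ∑ t ∈ E with t.1 = j, #{g ∈ Icc 1 #X | t.2 ⊆ level X g} := by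
  classical
  let hit (x : ι → Φ) (t : D × Finset (ι × Φ)) : Prop :=
    ∃ α ∈ t.2, ρ α = t.2.sup ρ ∧ α ∈ keySet x
  have hpair : ∀ x ∈ X, ∀ y ∈ X, x ≠ y → hashSum H x j = hashSum H y j →
      (∃ t ∈ E, t.1 = j ∧ hit x t) ∨ ∃ t ∈ E, t.1 = j ∧ hit y t := by
    intro x hx y hy hxy heq
    have hmem : (j, keySet x ∆ keySet y) ∈ collisions H X :=
      mem_collisions.2 ⟨x, hx, y, hy, hxy, heq, rfl⟩
    obtain ⟨t, ht, hj, hsup⟩ := hE.exists_mem _ hmem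
    obtain ⟨α, hα, htop⟩ := exists_mem_eq_sup _ (nonempty_of_mem_collisions (hE.subset ht)) ρ
    obtain ⟨β, hβ, htop'⟩ := exists_mem_eq_sup _ (nonempty_of_mem_collisions hmem) ρ
    obtain rfl : α = β := hρ.injective (htop.symm.trans (hsup.trans htop'))
    exact (mem_symmDiff.1 hβ).imp (fun h => ⟨t, ht, hj, α, hα, htop.symm, h.1⟩)
      fun h => ⟨t, ht, hj, α, hα, htop.symm, h.1⟩
  calc #X ≤ 2 * #{x ∈ X | ∃ t ∈ E, t.1 = j ∧ hit x t} := card_le_two_mul_card_filter hX hpair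
    _ ≤ 2 * #({t ∈ E | t.1 = j}.biUnion fun t => {x ∈ X | hit x t}) := by
      gcongr
      rintro x hx
      obtain ⟨hx, t, ht, hj, hxt⟩ := mem_filter.1 hx
      exact mem_biUnion.2 ⟨t, mem_filter.2 ⟨ht, hj⟩, mem_filter.2 ⟨hx, hxt⟩⟩
    _ ≤ 2 * ∑ t ∈ E with t.1 = j, #{g ∈ Icc 1 #X | t.2 ⊆ level X g} := by
      refine Nat.mul_le_mul_left 2 (card_biUnion_le.trans (sum_le_sum fun t ht => ?_))
      exact hρ.card_hit_le (nonempty_of_mem_collisions (hE.subset (mem_filter.1 ht).1))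

end Collisions

section Averaging

variable [Fintype Φ] [AddCommMonoid R] {d : ℕ} {H : ι × Φ → Fin d → R} {X : Finset (ι → Φ)}
  {ρ : ι × Φ → ℕ} {E : Finset (Fin d × Finset (ι × Φ))}

theorem IsPivotFamily.mul_card_le_two_mul_sum (hE : IsPivotFamily H X ρ E) (hρ : IsDegRank X ρ)
    (hX : ¬HasUniqueOutputChar (hashSum H) X) :
    d * #X ≤ 2 * ∑ g ∈ Icc 1 #X, #{t ∈ E | t.2 ⊆ level X g} :=
  calc d * #X = ∑ _j : Fin d, #X := by rw [sum_const, card_univ, Fintype.card_fin, smul_eq_mul]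
    _ ≤ ∑ j, 2 * ∑ t ∈ E with t.1 = j, #{g ∈ Icc 1 #X | t.2 ⊆ level X g} := sum_le_sum fun j _ =>
        hE.card_le_two_mul_sum hρ (exists_collision_of_not_hasUniqueOutputChar hX j)
    _ = 2 * ∑ t ∈ E, #{g ∈ Icc 1 #X | t.2 ⊆ level X g} := by rw [← mul_sum, sum_fiberwise]
    _ = 2 * ∑ g ∈ Icc 1 #X, #{t ∈ E | t.2 ⊆ level X g} := congrArg (2 * ·)
        (sum_card_bipartiteAbove_eq_sum_card_bipartiteBelow fun (t : Fin d × Finset (ι × Φ)) g =>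
          t.2 ⊆ level X g)

theorem IsPivotFamily.exists_dominating_mem (hE : IsPivotFamily H X ρ E) (hρ : IsDegRank X ρ)
    (hne : X.Nonempty) (hd : 0 < d) (hX : ¬HasUniqueOutputChar (hashSum H) X) :
    ∃ t₀ ∈ E, ∀ t ∈ E, ∀ g, t.2 ⊆ level X g → t₀.2 ⊆ level X g := by
  obtain ⟨x, hx⟩ := hne
  obtain ⟨y, hy, hyx, heq⟩ := exists_collision_of_not_hasUniqueOutputChar hX ⟨0, hd⟩ x hx
  have hmem : (⟨0, hd⟩, keySet y ∆ keySet x) ∈ collisions H X :=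
    mem_collisions.2 ⟨y, hy, x, hx, hyx, heq, rfl⟩
  obtain ⟨t, ht, -⟩ := hE.exists_mem _ hmem
  obtain ⟨t₀, ht₀, hmin⟩ := E.exists_min_image (fun t => t.2.sup ρ) ⟨t, ht⟩
  exact ⟨t₀, ht₀, fun t ht g hg => subset_level_of_sup_le hρ.lt_of_deg_lt
    (nonempty_of_mem_collisions (hE.subset ht)) (hmin t ht) hg⟩

theorem exists_level_mul_card_le (hE : IsPivotFamily H X ρ E) (hρ : IsDegRank X ρ)
    (hne : X.Nonempty) (hX : ¬HasUniqueOutputChar (hashSum H) X)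
    {t₀ : Fin d × Finset (ι × Φ)} (ht₀ : t₀ ∈ E)
    (hdom : ∀ t ∈ E, ∀ g, t.2 ⊆ level X g → t₀.2 ⊆ level X g) (i : ι) {L₁ L₂ N : ℕ}
    (hL : 2 * (L₁ + (Fintype.card ι - 1) * L₂) ≤ N * d) :
    ∃ g, 1 ≤ g ∧ t₀.2 ⊆ level X g ∧
      L₁ * #(charsAt (level X g) i) + L₂ * #(level X g \ charsAt (level X g) i)
        ≤ N * #{t ∈ E | t.2 ⊆ level X g} := by
  by_contra! hlt
  have hle : ∀ g ∈ Icc 1 #X, N * #{t ∈ E | t.2 ⊆ level X g}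
      ≤ L₁ * #(charsAt (level X g) i) + L₂ * #(level X g \ charsAt (level X g) i) := fun g hg => by
    by_cases hg₀ : t₀.2 ⊆ level X g
    · exact (hlt g (mem_Icc.1 hg).1 hg₀).le
    · rw [filter_eq_empty_iff.2 fun t ht hg => hg₀ (hdom t ht g hg), card_empty, mul_zero]
      exact Nat.zero_le _
  have hone : t₀.2 ⊆ level X 1 := by
    obtain ⟨x, hx, y, hy, -, -, ht₀⟩ := mem_collisions.1 (hE.subset ht₀)
    rw [ht₀]
    exact symmDiff_subset_union.trans
      (union_subset (keySet_subset_level_one hx) (keySet_subset_level_one hy))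
  have hsum : N * ∑ g ∈ Icc 1 #X, #{t ∈ E | t.2 ⊆ level X g}
      < L₁ * #X + L₂ * ((Fintype.card ι - 1) * #X) := by
    have hsum_lt := sum_lt_sum hle ⟨1, mem_Icc.2 ⟨le_rfl, card_pos.2 hne⟩, hlt 1 le_rfl hone⟩
    rwa [sum_add_distrib, ← mul_sum, ← mul_sum, ← mul_sum, sum_card_charsAt_level,
      sum_card_level_sdiff_charsAt] at hsum_lt
  have hcover := Nat.mul_le_mul_left N (hE.mul_card_le_two_mul_sum hρ hX)
  have hweights := Nat.mul_le_mul_right #X hL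
  nlinarith

end Averaging

end Keys

section CollisionSystem

variable {ι Φ D R : Type*} [DecidableEq ι] [DecidableEq Φ]

/-- A nonempty set of characters of `S` with no or two characters in each position. The
symmetric difference of two keys has this shape. -/
structure IsDiff (S e : Finset (ι × Φ)) : Prop where
  subset : e ⊆ S
  nonempty : e.Nonempty
  card_charsAt : ∀ i, #(charsAt e i) = 0 ∨ #(charsAt e i) = 2

theorem isDiff_pair {S : Finset (ι × Φ)} {α β : ι × Φ} (hα : α ∈ S) (hβ : β ∈ S) (hne : α ≠ β)
    (hpos : α.1 = β.1) : IsDiff S {α, β} := by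
  refine ⟨insert_subset hα (singleton_subset_iff.2 hβ), insert_nonempty _ _, fun i => ?_⟩
  by_cases hi : α.1 = i
  · right
    rw [charsAt, filter_true_of_mem fun γ hγ => ?_, card_pair hne]
    rcases mem_insert.1 hγ with rfl | hγ
    · exact hi
    · rw [mem_singleton.1 hγ, ← hpos, hi]
  · left
    rw [charsAt, filter_false_of_mem fun γ hγ => ?_, card_empty]
    rcases mem_insert.1 hγ with rfl | hγ
    · exact hi
    · rwa [mem_singleton.1 hγ, ← hpos]

/-- A set of characters of `S` with at most one character in each position: the part in `S` of a
key. -/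
structure IsTrace (S u : Finset (ι × Φ)) : Prop where
  subset : u ⊆ S
  card_charsAt_le_one : ∀ i, #(charsAt u i) ≤ 1

/-- The relations `E` between characters of `S` are the differences of pairs among at most `k`
traces of keys. -/
def Traced (k : ℕ) (S : Finset (ι × Φ)) (E : Finset (D × Finset (ι × Φ))) : Prop :=
  ∃ Q : Finset (Finset (ι × Φ)), #Q ≤ k ∧ (∀ u ∈ Q, IsTrace S u) ∧
    ∀ t ∈ E, ∃ u ∈ Q, ∃ v ∈ Q, t.2 = u ∆ v

theorem Traced.mono {k : ℕ} {S : Finset (ι × Φ)} {E E' : Finset (D × Finset (ι × Φ))}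
    (h : Traced k S E) (hE : E' ⊆ E) : Traced k S E' :=
  let ⟨Q, hQ, htrace, hdiff⟩ := h
  ⟨Q, hQ, htrace, fun t ht => hdiff t (hE ht)⟩

/-- A system of relations between the characters of `S` as it arises from collisions of at most `k`
keys under the tables `H`. -/
structure IsCollisionSystem [AddCommMonoid R] (k : ℕ) (H : ι × Φ → D → R) (ρ : ι × Φ → ℕ)
    (S : Finset (ι × Φ)) (E : Finset (D × Finset (ι × Φ))) : Prop where
  card_charsAt_le : ∀ i, #(charsAt S i) ≤ k
  triangular : Triangular ρ E
  holds : Holds H E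
  isDiff : ∀ t ∈ E, IsDiff S t.2
  traced : Traced k S E

theorem IsCollisionSystem.mono [AddCommMonoid R] {k : ℕ} {H : ι × Φ → D → R} {ρ : ι × Φ → ℕ}
    {S : Finset (ι × Φ)} {E E' : Finset (D × Finset (ι × Φ))} (h : IsCollisionSystem k H ρ S E)
    (hE : E' ⊆ E) : IsCollisionSystem k H ρ S E' where
  card_charsAt_le := h.card_charsAt_le
  triangular := h.triangular.mono hE
  holds := h.holds.mono hE
  isDiff t ht := h.isDiff t (hE ht)
  traced := h.traced.mono hE

variable [Fintype ι]

theorem isTrace_keySet_inter (x : ι → Φ) (S : Finset (ι × Φ)) : IsTrace S (keySet x ∩ S) := by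
  refine ⟨inter_subset_right, fun i => card_le_one.2 fun α hα β hβ => ?_⟩
  obtain ⟨hαS, hi⟩ := mem_charsAt.1 hα
  obtain ⟨hβS, hj⟩ := mem_charsAt.1 hβ
  have hpos : α.1 = β.1 := hi.trans hj.symm
  have hxα := mem_keySet.1 (mem_inter.1 hαS).1
  have hxβ := mem_keySet.1 (mem_inter.1 hβS).1
  exact Prod.ext hpos (by rw [← hxα, ← hxβ, hpos])

theorem traced_collisions [Fintype Φ] [Fintype D] [AddCommMonoid R] {H : ι × Φ → D → R}
    {X : Finset (ι → Φ)} {k : ℕ} (hk : #X ≤ k) {S : Finset (ι × Φ)}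
    {E : Finset (D × Finset (ι × Φ))} (hE : E ⊆ collisions H X) (hS : ∀ t ∈ E, t.2 ⊆ S) :
    Traced k S E := by
  refine ⟨X.image fun x => keySet x ∩ S, card_image_le.trans hk, ?_, fun t ht => ?_⟩
  · simpa only [forall_mem_image] using fun x _ => isTrace_keySet_inter x S
  · obtain ⟨x, hx, y, hy, -, -, hdiff⟩ := mem_collisions.1 (hE ht)
    refine ⟨_, mem_image_of_mem _ hx, _, mem_image_of_mem _ hy, ?_⟩
    rw [← inf_eq_inter, ← inf_eq_inter, ← inf_symmDiff_distrib_right, ← hdiff]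
    exact (inf_eq_left.2 (hS t ht)).symm

theorem IsPivotFamily.isCollisionSystem_level [Fintype Φ] [Fintype D] [AddCommGroup R]
    [Module (ZMod 2) R] {H : ι × Φ → D → R} {X : Finset (ι → Φ)} {ρ : ι × Φ → ℕ}
    {E : Finset (D × Finset (ι × Φ))} (hE : IsPivotFamily H X ρ E) {k : ℕ} (hk : #X ≤ k) {g : ℕ}
    (hg : 1 ≤ g) :
    IsCollisionSystem k H ρ (level X g) {t ∈ E | t.2 ⊆ level X g} where
  card_charsAt_le i := (card_charsAt_level_le X hg i).trans hk
  triangular := hE.triangular.mono (filter_subset _ _)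
  holds := (holds_collisions H X).mono ((filter_subset _ _).trans hE.subset)
  isDiff t ht := by
    obtain ⟨ht, hlevel⟩ := mem_filter.1 ht
    have hmem := hE.subset ht
    obtain ⟨x, -, y, -, -, -, hdiff⟩ := mem_collisions.1 hmem
    exact ⟨hlevel, nonempty_of_mem_collisions hmem, hdiff ▸ card_charsAt_keySet_symmDiff x y⟩
  traced := traced_collisions hk ((filter_subset _ _).trans hE.subset) fun _ ht =>
    (mem_filter.1 ht).2

-- The two characters `α`, `β` do not depend on the weights `L₁`, `L₂`, so that the weights may be
-- adapted to the number of output positions in which the tables agree on `α` and `β`.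
theorem exists_isCollisionSystem [Finite Φ] [AddCommGroup R] [Module (ZMod 2) R] {d : ℕ}
    (hd : 0 < d) {H : ι × Φ → Fin d → R} {X : Finset (ι → Φ)} {k : ℕ} (hk : #X ≤ k)
    (hne : X.Nonempty) (hX : ¬HasUniqueOutputChar (hashSum H) X) :
    ∃ ρ α β, α ≠ β ∧ α.1 = β.1 ∧
      ∀ L₁ L₂ N, 2 * (L₁ + (Fintype.card ι - 1) * L₂) ≤ N * d →
        ∃ S E, IsCollisionSystem k H ρ S E ∧ α ∈ S ∧ β ∈ S ∧
          L₁ * #(charsAt S α.1) + L₂ * #(S \ charsAt S α.1) ≤ N * #E := by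
  cases nonempty_fintype Φ
  obtain ⟨ρ, hρ⟩ := exists_isDegRank X
  obtain ⟨E, hE⟩ := exists_isPivotFamily H X ρ
  obtain ⟨t₀, ht₀, hdom⟩ := hE.exists_dominating_mem hρ hne hd hX
  obtain ⟨α, β, hαβ, hpos, hα, hβ⟩ := exists_pair_of_mem_collisions (hE.subset ht₀)
  refine ⟨ρ, α, β, hαβ, hpos, fun L₁ L₂ N hL => ?_⟩
  obtain ⟨g, hg, ht₀g, hle⟩ := exists_level_mul_card_le hE hρ hne hX ht₀ hdom α.1 hL
  exact ⟨level X g, _, hE.isCollisionSystem_level hk hg, ht₀g hα, ht₀g hβ, hle⟩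

end CollisionSystem

/-! ### Counting families of relations -/

theorem prod_le_sum_pow_div {κ : Type*} (I : Finset κ) (n : κ → ℕ) :
    ∏ i ∈ I, n i ≤ (∑ i ∈ I, n i) ^ #I / #I ^ #I := by
  rcases I.eq_empty_or_nonempty with rfl | hI
  · simp
  have hcard : 0 < #I := card_pos.2 hI
  rw [Nat.le_div_iff_mul_le (pow_pos hcard _)]
  have hmean : (∏ i ∈ I, (n i : ℝ)) ^ (#I : ℝ)⁻¹ ≤ (∑ i ∈ I, (n i : ℝ)) / #I := by
    simpa using Real.geom_mean_le_arith_mean I 1 (fun i => (n i : ℝ)) (fun _ _ => zero_le_one)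
      (by simpa using hcard) fun i _ => Nat.cast_nonneg _
  have hprod : 0 ≤ ∏ i ∈ I, (n i : ℝ) := prod_nonneg fun i _ => Nat.cast_nonneg _
  have hpow := pow_le_pow_left₀ (Real.rpow_nonneg hprod _) hmean #I
  rw [Real.rpow_inv_natCast_pow hprod hcard.ne', div_pow, le_div_iff₀ (by positivity)] at hpow
  exact_mod_cast hpow

/-- An upper bound for `n.choose k`, by the inequality of arithmetic and geometric means applied to
the factors of `n * (n - 1) * ⋯ * (n - k + 1)`. Unlike the recursively defined `n.choose k`, it can
be evaluated for large `n`. -/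
def binomialBound (n k : ℕ) : ℕ := (n * k - k * (k - 1) / 2) ^ k / (k ^ k * k.factorial)

theorem choose_le_binomialBound {n N : ℕ} (h : n ≤ N) (k : ℕ) :
    n.choose k ≤ binomialBound N k := by
  refine (Nat.choose_le_choose k h).trans ?_
  rcases lt_or_ge N k with hk | hk
  · exact (Nat.choose_eq_zero_of_lt hk).trans_le (Nat.zero_le _)
  have hsum : ∑ i ∈ range k, (N - i) = N * k - k * (k - 1) / 2 := by
    rw [sum_tsub_distrib _ fun i hi => (mem_range.1 hi).le.trans hk, sum_range_id, sum_const,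
      card_range, smul_eq_mul, mul_comm]
  have hprod := prod_le_sum_pow_div (range k) fun i => N - i
  rw [← Nat.descFactorial_eq_prod_range, hsum, card_range] at hprod
  rw [Nat.choose_eq_descFactorial_div_factorial, binomialBound, ← Nat.div_div_eq_div_mul]
  exact Nat.div_le_div_right hprod

/-- The number of sets with no or two elements in a set of `n` elements. -/
def pairCount (n : ℕ) : ℕ := n * (n - 1) / 2 + 1

/-- The value of `∏ i, pairCount (n i)` for `t` numbers that sum to `n` and are nearly equal. -/
def balanced (t n : ℕ) : ℕ := ∏ i ∈ range t, pairCount ((n + i) / t)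

/-- A bound for `∏ i, pairCount (n i)` for at most `t` numbers that sum to `n`. -/
def pairBound : ℕ → ℕ → ℕ
  | 0, _ => 1
  | t + 1, n => max (pairBound t n) (balanced (t + 1) n)

theorem pairCount_mul_pairBound_le : ∀ t < 3, ∀ n ≤ 70, ∀ i ≤ n,
    pairCount i * pairBound t (n - i) ≤ pairBound (t + 1) n := by
  decide +kernel

theorem prod_pairCount_le {κ : Type*} (I : Finset κ) (n : κ → ℕ) (hI : #I ≤ 3)
    (hn : ∑ i ∈ I, n i ≤ 70) : ∏ i ∈ I, pairCount (n i) ≤ pairBound #I (∑ i ∈ I, n i) := by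
  classical
  induction I using Finset.induction_on with
  | empty => rfl
  | insert a I ha ih =>
    rw [card_insert_of_notMem ha] at hI ⊢
    rw [sum_insert ha] at hn ⊢
    rw [prod_insert ha]
    refine (Nat.mul_le_mul_left _ (ih (by omega) (by omega))).trans ?_
    have hstep := pairCount_mul_pairBound_le #I (by omega) _ hn (n a) (by omega)
    rwa [Nat.add_sub_cancel_left] at hstep

theorem card_image_offDiag_le {α β : Type*} [DecidableEq β] (Q : Finset α)
    {f : α → α → β} (hf : ∀ a b, f a b = f b a) :
    #(Q.offDiag.image fun p => f p.1 p.2) ≤ (#Q).choose 2 := by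
  classical
  have hlift : Q.offDiag.image (fun p => f p.1 p.2) =
      (Q.offDiag.image Sym2.mk.uncurry).image (Sym2.lift ⟨f, hf⟩) := by
    rw [image_image]
    rfl
  rw [hlift, ← Sym2.card_image_offDiag]
  exact card_image_le

theorem exists_cover_of_card_le {α : Type*} (T : Finset α) (k : ℕ) :
    ∃ C : Finset (Finset α), #C ≤ (max #T k).choose k ∧ (∀ Q ∈ C, #Q ≤ k) ∧
      ∀ Q ⊆ T, #Q ≤ k → ∃ Q' ∈ C, Q ⊆ Q' := by
  rcases le_total k #T with h | h
  · refine ⟨powersetCard k T, ?_, fun Q hQ => (mem_powersetCard.1 hQ).2.le, fun Q hQ hk => ?_⟩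
    · rw [card_powersetCard, max_eq_left h]
    · obtain ⟨Q', hQQ', hQ', hcard⟩ := exists_subsuperset_card_eq hQ hk h
      exact ⟨Q', mem_powersetCard.2 ⟨hQ', hcard⟩, hQQ'⟩
  · refine ⟨{T}, ?_, fun Q hQ => (mem_singleton.1 hQ) ▸ h, fun Q hQ _ => ?_⟩
    · rw [card_singleton, max_eq_right h, Nat.choose_self]
    · exact ⟨T, mem_singleton_self T, hQ⟩

section Families

variable {ι Φ D : Type*} [DecidableEq ι]

theorem card_le_prod_of_forall_charsAt_mem [Fintype ι] {T : Finset (Finset (ι × Φ))}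
    {W : ι → Finset (Finset (ι × Φ))} (h : ∀ e ∈ T, ∀ i, charsAt e i ∈ W i) :
    #T ≤ ∏ i, #(W i) := by
  rw [← Fintype.card_piFinset]
  refine card_le_card_of_injOn (fun e => charsAt e)
    (fun e he => Fintype.mem_piFinset.2 (h e he)) fun e _ e' _ heq => ?_
  ext α
  have hiff : α ∈ charsAt e α.1 ↔ α ∈ charsAt e' α.1 := iff_of_eq (congrArg (α ∈ · α.1) heq)
  simpa only [mem_charsAt, and_true] using hiff

section Possible

variable [Fintype ι] [Fintype Φ]

open Classical in
/-- The possible differences of two keys in the characters `S`. -/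
noncomputable def diffs (S : Finset (ι × Φ)) : Finset (Finset (ι × Φ)) := {e | IsDiff S e}

theorem mem_diffs {S e : Finset (ι × Φ)} : e ∈ diffs S ↔ IsDiff S e := by
  simp only [diffs, mem_filter_univ]

theorem empty_notMem_diffs (S : Finset (ι × Φ)) : ∅ ∉ diffs S := fun h =>
  not_nonempty_empty (mem_diffs.1 h).nonempty

open Classical in
/-- The possible traces of keys in the characters `S`. -/
noncomputable def traces (S : Finset (ι × Φ)) : Finset (Finset (ι × Φ)) := {u | IsTrace S u}

theorem mem_traces {S u : Finset (ι × Φ)} : u ∈ traces S ↔ IsTrace S u := by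
  simp only [traces, mem_filter_univ]

theorem card_diffs_lt (S : Finset (ι × Φ)) : #(diffs S) < ∏ i, pairCount #(charsAt S i) := by
  classical
  have hW : ∀ e ∈ insert ∅ (diffs S), ∀ i,
      charsAt e i ∈ insert ∅ (powersetCard 2 (charsAt S i)) := by
    intro e he i
    rw [mem_insert, mem_powersetCard]
    rcases mem_insert.1 he with rfl | he
    · exact Or.inl rfl
    · obtain ⟨hS, -, hcard⟩ := mem_diffs.1 he
      exact (hcard i).imp card_eq_zero.1 fun h => ⟨charsAt_mono hS i, h⟩
  rw [← Nat.add_one_le_iff, ← card_insert_of_notMem (empty_notMem_diffs S)]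
  refine (card_le_prod_of_forall_charsAt_mem hW).trans (prod_le_prod' fun i _ => ?_)
  refine (card_insert_le _ _).trans_eq ?_
  rw [card_powersetCard, Nat.choose_two_right, pairCount]

theorem card_traces_le (S : Finset (ι × Φ)) : #(traces S) ≤ ∏ i, (#(charsAt S i) + 1) := by
  classical
  have hW : ∀ u ∈ traces S, ∀ i, charsAt u i ∈ insert ∅ (powersetCard 1 (charsAt S i)) := by
    intro u hu i
    obtain ⟨hS, hcard⟩ := mem_traces.1 hu
    rw [mem_insert, mem_powersetCard]
    exact (Nat.le_one_iff_eq_zero_or_eq_one.1 (hcard i)).imp card_eq_zero.1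
      fun h => ⟨charsAt_mono hS i, h⟩
  refine (card_le_prod_of_forall_charsAt_mem hW).trans (prod_le_prod' fun i _ => ?_)
  refine (card_insert_le _ _).trans_eq ?_
  rw [card_powersetCard, Nat.choose_one_right]

end Possible

variable [DecidableEq Φ] [Fintype D]

open Classical in
/-- The families of `r` relations with character sets in `T` that come from at most `k` traces. -/
noncomputable def tracedFamilies (D : Type*) [Fintype D] (k r : ℕ) (S : Finset (ι × Φ))
    (T : Finset (Finset (ι × Φ))) : Finset (Finset (D × Finset (ι × Φ))) :=
  {E ∈ powersetCard r (univ ×ˢ T) | Traced k S E}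

theorem mem_tracedFamilies {k r : ℕ} {S : Finset (ι × Φ)} {T : Finset (Finset (ι × Φ))}
    {E : Finset (D × Finset (ι × Φ))} :
    E ∈ tracedFamilies D k r S T ↔ (∀ t ∈ E, t.2 ∈ T) ∧ #E = r ∧ Traced k S E := by
  simp only [tracedFamilies, mem_filter, mem_powersetCard, subset_iff, mem_product, mem_univ,
    true_and, and_assoc]

theorem card_tracedFamilies_le_choose (k r : ℕ) (S : Finset (ι × Φ))
    (T : Finset (Finset (ι × Φ))) :
    #(tracedFamilies D k r S T) ≤ (Fintype.card D * #T).choose r := by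
  classical
  refine (card_filter_le _ _).trans_eq ?_
  rw [card_powersetCard, card_product, card_univ]

theorem card_tracedFamilies_le_choose_mul_choose [Fintype ι] [Fintype Φ] (k r : ℕ)
    (S : Finset (ι × Φ)) {T : Finset (Finset (ι × Φ))} (hT : ∅ ∉ T) :
    #(tracedFamilies D k r S T) ≤
      (max #(traces S) k).choose k * (Fintype.card D * k.choose 2).choose r := by
  classical
  obtain ⟨C, hCcard, hCk, hC⟩ := exists_cover_of_card_le (traces S) k
  let differences (Q : Finset (Finset (ι × Φ))) := Q.offDiag.image fun p => p.1 ∆ p.2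
  have hcover : tracedFamilies D k r S T ⊆
      C.biUnion fun Q => powersetCard r (univ ×ˢ differences Q) := fun E hE => by
    obtain ⟨hET, hr, Q, hQ, htrace, hdiff⟩ := mem_tracedFamilies.1 hE
    obtain ⟨Q', hQ', hQQ'⟩ := hC Q (fun u hu => mem_traces.2 (htrace u hu)) hQ
    refine mem_biUnion.2 ⟨Q', hQ', mem_powersetCard.2 ⟨fun t ht => ?_, hr⟩⟩
    obtain ⟨u, hu, v, hv, huv⟩ := hdiff t ht
    have hne : u ≠ v := fun h => hT (by simpa [huv, h] using hET t ht)
    exact mem_product.2 ⟨mem_univ _, mem_image.2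
      ⟨(u, v), mem_offDiag.2 ⟨hQQ' hu, hQQ' hv, hne⟩, huv.symm⟩⟩
  refine (card_le_card hcover).trans ((card_biUnion_le_card_mul _ _ _ fun Q hQ => ?_).trans
    (Nat.mul_le_mul_right _ hCcard))
  rw [card_powersetCard, card_product, card_univ]
  refine Nat.choose_le_choose r (Nat.mul_le_mul_left _ ?_)
  exact (card_image_offDiag_le Q symmDiff_comm).trans (Nat.choose_le_choose 2 (hCk Q hQ))

end Families

/-! ### Certificates -/

section Agreements

variable {A D R : Type*} [AddCommMonoid R]

theorem triangular_product_singleton (ρ : A → ℕ) (J : Finset D) {e : Finset A}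
    (he : e.Nonempty) : Triangular ρ (J ×ˢ {e}) := by
  have hmem : ∀ t ∈ J ×ˢ {e}, t.2 = e := fun t ht => mem_singleton.1 (mem_product.1 ht).2
  exact ⟨fun t ht => hmem t ht ▸ he, fun t ht t' ht' heq =>
    Prod.ext (Prod.ext_iff.1 heq).1 ((hmem t ht).trans (hmem t' ht').symm)⟩

variable [Fintype D]

open Classical in
/-- The output positions in which the values of `α` and `β` sum to zero; for bit strings, those in
which `α` and `β` have the same value. -/
noncomputable def agreements (H : A → D → R) (α β : A) : Finset D := {j | H α j + H β j = 0}

theorem mem_agreements {H : A → D → R} {α β : A} {j : D} :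
    j ∈ agreements H α β ↔ H α j + H β j = 0 := by
  simp only [agreements, mem_filter_univ]

theorem holds_agreements_product [DecidableEq A] (H : A → D → R) {α β : A} (hne : α ≠ β)
    {J : Finset D} (hJ : J ⊆ agreements H α β) : Holds H (J ×ˢ {{α, β}}) := fun t ht => by
  obtain ⟨hj, he⟩ := mem_product.1 ht
  rw [mem_singleton.1 he, sum_pair hne]
  exact mem_agreements.1 (hJ hj)

theorem mem_agreements_product_of_holds [DecidableEq A] {H : A → D → R} {α β : A} (hne : α ≠ β)
    {E : Finset (D × Finset A)} (hE : Holds H E) {t : D × Finset A} (ht : t ∈ E)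
    (he : t.2 = {α, β}) : t ∈ agreements H α β ×ˢ {{α, β}} := by
  have hsum := hE t ht
  rw [he, sum_pair hne] at hsum
  exact mem_product.2 ⟨mem_agreements.2 hsum, mem_singleton.2 he⟩

end Agreements

theorem pair_mem_powersetCard_charsAt {ι Φ : Type*} [DecidableEq ι] [DecidableEq Φ]
    {S : Finset (ι × Φ)} {α β : ι × Φ} (hα : α ∈ S) (hβ : β ∈ S) (hne : α ≠ β) (hpos : α.1 = β.1) :
    {α, β} ∈ powersetCard 2 (charsAt S α.1) :=
  mem_powersetCard.2 ⟨insert_subset (mem_charsAt.2 ⟨hα, rfl⟩)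
    (singleton_subset_iff.2 (mem_charsAt.2 ⟨hβ, hpos.symm⟩)), card_pair hne⟩

section Certificates

variable {ι Φ D R : Type*} [Fintype ι] [DecidableEq ι] [Fintype Φ]

theorem card_charsAt_univ (i : ι) : #(charsAt (univ : Finset (ι × Φ)) i) = Fintype.card Φ := by
  have hprod : charsAt (univ : Finset (ι × Φ)) i = {i} ×ˢ univ := by
    ext ⟨j, b⟩
    simp [mem_charsAt, eq_comm]
  rw [hprod, card_product, card_singleton, one_mul, card_univ]

variable [DecidableEq Φ]

theorem card_univ_sdiff_charsAt (i : ι) :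
    #(univ \ charsAt (univ : Finset (ι × Φ)) i) = (Fintype.card ι - 1) * Fintype.card Φ := by
  rw [card_univ_sdiff, Fintype.card_prod, card_charsAt_univ, Nat.sub_mul, one_mul]

/-- The sets with `a` characters in the position `i` and `s` characters in the other positions. -/
def splitSets (Φ : Type*) [Fintype Φ] [DecidableEq Φ] (i : ι) (a s : ℕ) :
    Finset (Finset (ι × Φ)) :=
  {S | #(charsAt S i) = a ∧ #(S \ charsAt S i) = s}

theorem card_splitSets_le (i : ι) (a s : ℕ) :
    #(splitSets Φ i a s) ≤
      (Fintype.card Φ).choose a * ((Fintype.card ι - 1) * Fintype.card Φ).choose s := by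
  have hcard : #(powersetCard a (charsAt (univ : Finset (ι × Φ)) i) ×ˢ
      powersetCard s (univ \ charsAt (univ : Finset (ι × Φ)) i)) =
      (Fintype.card Φ).choose a * ((Fintype.card ι - 1) * Fintype.card Φ).choose s := by
    rw [card_product, card_powersetCard, card_powersetCard, card_charsAt_univ,
      card_univ_sdiff_charsAt]
  rw [← hcard]
  refine card_le_card_of_injOn (fun S => (charsAt S i, S \ charsAt S i)) (fun S hS => ?_)
    fun S _ T _ heq => ?_
  · obtain ⟨ha, hs⟩ := (mem_filter_univ _).1 hS
    refine mem_product.2 ⟨mem_powersetCard.2 ⟨charsAt_mono (subset_univ S) i, ha⟩,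
      mem_powersetCard.2 ⟨fun α hα => ?_, hs⟩⟩
    simp_all [mem_charsAt]
  · have hS : ∀ S : Finset (ι × Φ), charsAt S i ∪ S \ charsAt S i = S := fun S =>
      union_sdiff_of_subset (filter_subset _ S)
    obtain ⟨hi, hother⟩ := Prod.mk.inj heq
    exact (hS S).symm.trans ((congrArg₂ (· ∪ ·) hi hother).trans (hS T))

variable [Fintype D]

/-- The families that relate one pair of characters in `q` output positions. -/
def pairCertificates (ι Φ D : Type*) [Fintype ι] [DecidableEq ι] [Fintype Φ] [DecidableEq Φ]
    [Fintype D] [DecidableEq D] (q : ℕ) : Finset (Finset (D × Finset (ι × Φ))) :=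
  univ.biUnion fun i => (powersetCard 2 (charsAt univ i)).biUnion fun e =>
    (powersetCard q univ).image (· ×ˢ {e})

/-- The families of `r` relations among `n` characters. -/
noncomputable def levelCertificates (ι Φ D : Type*) [Fintype ι] [DecidableEq ι] [Fintype Φ]
    [DecidableEq Φ] [Fintype D] [DecidableEq D] (k n r : ℕ) :
    Finset (Finset (D × Finset (ι × Φ))) :=
  (powersetCard n univ).biUnion fun S => tracedFamilies D k r S (diffs S)

/-- The families of relations among `a` characters in one input position and `s` characters in the
other ones, that consist of `p` relations between the same two of the `a` characters and of `q`
other relations. -/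
noncomputable def forcedCertificates (ι Φ D : Type*) [Fintype ι] [DecidableEq ι] [Fintype Φ]
    [DecidableEq Φ] [Fintype D] [DecidableEq D] (k p a s q : ℕ) :
    Finset (Finset (D × Finset (ι × Φ))) :=
  univ.biUnion fun i => (splitSets Φ i a s).biUnion fun S =>
    (powersetCard 2 (charsAt S i)).biUnion fun e => (powersetCard p univ).biUnion fun J =>
      (tracedFamilies D k q S ((diffs S).erase e)).image (J ×ˢ {e} ∪ ·)

variable [DecidableEq D]

theorem card_pairCertificates_le (q : ℕ) :
    #(pairCertificates ι Φ D q) ≤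
      Fintype.card ι * ((Fintype.card Φ).choose 2 * (Fintype.card D).choose q) := by
  refine card_biUnion_le_card_mul _ _ _ fun i _ => ?_
  rw [← card_charsAt_univ (Φ := Φ) i, ← card_powersetCard]
  refine card_biUnion_le_card_mul _ _ _ fun e _ => card_image_le.trans_eq ?_
  rw [card_powersetCard, card_univ]

theorem card_levelCertificates_le {k n r N : ℕ} (hN : ∀ S : Finset (ι × Φ), #S = n →
    #(tracedFamilies D k r S (diffs S)) ≤ N) :
    #(levelCertificates ι Φ D k n r) ≤
      (Fintype.card ι * Fintype.card Φ).choose n * N := by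
  rw [← Fintype.card_prod, ← card_univ, ← card_powersetCard]
  exact card_biUnion_le_card_mul _ _ _ fun S hS => hN S (mem_powersetCard.1 hS).2

theorem card_forcedCertificates_le {k p a s q N : ℕ}
    (hN : ∀ (i : ι) (S e : Finset (ι × Φ)), #(charsAt S i) = a → #(S \ charsAt S i) = s →
      e ∈ powersetCard 2 (charsAt S i) → #(tracedFamilies D k q S ((diffs S).erase e)) ≤ N) :
    #(forcedCertificates ι Φ D k p a s q) ≤ Fintype.card ι *
      ((Fintype.card Φ).choose a * ((Fintype.card ι - 1) * Fintype.card Φ).choose s *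
        (a.choose 2 * ((Fintype.card D).choose p * N))) := by
  refine card_biUnion_le_card_mul _ _ _ fun i _ => ?_
  refine le_trans ?_ (Nat.mul_le_mul_right _ (card_splitSets_le i a s))
  refine card_biUnion_le_card_mul _ _ _ fun S hS => ?_
  obtain ⟨ha, hs⟩ := (mem_filter_univ _).1 hS
  rw [← ha, ← card_powersetCard]
  refine card_biUnion_le_card_mul _ _ _ fun e he => ?_
  rw [← card_univ, ← card_powersetCard]
  exact card_biUnion_le_card_mul _ _ _ fun J _ => card_image_le.trans (hN i S e ha hs he)

theorem certified_pairCertificates [AddCommMonoid R] {H : ι × Φ → D → R} {α β : ι × Φ}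
    (hne : α ≠ β) (hpos : α.1 = β.1) {k q : ℕ} (hk : 2 ≤ k) (hq : q ≤ #(agreements H α β)) :
    Certified k H (pairCertificates ι Φ D q) q := by
  obtain ⟨J, hJ, hcard⟩ := exists_subset_card_eq hq
  have hpair := pair_mem_powersetCard_charsAt (mem_univ α) (mem_univ β) hne hpos
  have hmem : J ×ˢ {{α, β}} ∈ pairCertificates ι Φ D q :=
    mem_biUnion.2 ⟨α.1, mem_univ _, mem_biUnion.2 ⟨{α, β}, hpair,
      mem_image.2 ⟨J, mem_powersetCard_univ.2 hcard, rfl⟩⟩⟩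
  have hE : Triangular (fun _ => 0) (J ×ˢ {({α, β} : Finset (ι × Φ))}) :=
    triangular_product_singleton _ J (insert_nonempty α {β})
  refine ⟨_, hmem, ?_, hE.isEchelon (S := {α, β}) (fun t ht => ?_) fun i => ?_,
    holds_agreements_product H hne hJ⟩
  · rw [card_product, card_singleton, mul_one, hcard]
  · exact (mem_singleton.1 (mem_product.1 ht).2).subset
  · exact (card_filter_le _ _).trans (card_le_two.trans hk)

namespace IsCollisionSystem

variable [AddCommMonoid R] {k : ℕ} {H : ι × Φ → D → R} {ρ : ι × Φ → ℕ} {S : Finset (ι × Φ)}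
  {E : Finset (D × Finset (ι × Φ))}

theorem certified_levelCertificates (h : IsCollisionSystem k H ρ S E) {r : ℕ} (hr : r ≤ #E) :
    Certified k H (levelCertificates ι Φ D k #S r) r := by
  obtain ⟨F, hF, hcard⟩ := exists_subset_card_eq hr
  have hS := h.mono hF
  exact ⟨F, mem_biUnion.2 ⟨S, mem_powersetCard_univ.2 rfl, mem_tracedFamilies.2
    ⟨fun t ht => mem_diffs.2 (hS.isDiff t ht), hcard, hS.traced⟩⟩, hcard,
    hS.triangular.isEchelon (fun t ht => (hS.isDiff t ht).subset) hS.card_charsAt_le, hS.holds⟩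

-- All agreements of `α` and `β` are put into the certificate; hence `E` can only contribute
-- relations other than `{α, β}`, which leaves fewer candidates.
theorem certified_forcedCertificates (h : IsCollisionSystem k H ρ S E) {α β : ι × Φ}
    (hα : α ∈ S) (hβ : β ∈ S) (hne : α ≠ β) (hpos : α.1 = β.1) {q : ℕ}
    (hq : q + #(agreements H α β) ≤ #E) :
    Certified k H (forcedCertificates ι Φ D k #(agreements H α β) #(charsAt S α.1)
      #(S \ charsAt S α.1) q) (q + #(agreements H α β)) := by
  set J := agreements H α β
  set P : Finset (D × Finset (ι × Φ)) := J ×ˢ {{α, β}}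
  have hP : Triangular ρ P := triangular_product_singleton ρ J (insert_nonempty α {β})
  have hPcard : #P = #J := by rw [card_product, card_singleton, mul_one]
  obtain ⟨F, hFE, hdisjoint, htriangular, hcard⟩ := hP.exists_extension h.triangular
  obtain ⟨F', hF'F, hF'⟩ := exists_subset_card_eq (show q ≤ #F by omega)
  have hsystem := h.mono (hF'F.trans hFE)
  have hF'diff : ∀ t ∈ F', t.2 ∈ (diffs S).erase {α, β} := fun t ht =>
    mem_erase.2 ⟨fun he => disjoint_left.1 hdisjoint
      (mem_agreements_product_of_holds hne hsystem.holds ht he) (hF'F ht),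
      mem_diffs.2 (hsystem.isDiff t ht)⟩
  have hsubset : ∀ t ∈ P ∪ F', t.2 ⊆ S := fun t ht => by
    rcases mem_union.1 ht with ht | ht
    · rw [mem_singleton.1 (mem_product.1 ht).2]
      exact (isDiff_pair hα hβ hne hpos).subset
    · exact (hsystem.isDiff t ht).subset
  refine ⟨P ∪ F', ?_, ?_, ?_, fun t ht => ?_⟩
  · exact mem_biUnion.2 ⟨α.1, mem_univ _, mem_biUnion.2 ⟨S, (mem_filter_univ _).2 ⟨rfl, rfl⟩,
      mem_biUnion.2 ⟨_, pair_mem_powersetCard_charsAt hα hβ hne hpos, mem_biUnion.2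
        ⟨J, mem_powersetCard_univ.2 rfl, mem_image_of_mem _ (mem_tracedFamilies.2
          ⟨hF'diff, hF', hsystem.traced⟩)⟩⟩⟩⟩
  · rw [card_union_of_disjoint (hdisjoint.mono_right hF'F), hPcard, hF', add_comm]
  · exact (htriangular.mono (union_subset_union_right hF'F)).isEchelon hsubset h.card_charsAt_le
  · exact (mem_union.1 ht).elim (holds_agreements_product H hne Subset.rfl t) (hsystem.holds t)

end IsCollisionSystem

end Certificates

/-! ### The union bound -/

section CharacterCounts

variable {ι Φ : Type*} [Fintype ι] [DecidableEq ι]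

theorem card_erase_univ (i : ι) : #(univ.erase i) = Fintype.card ι - 1 := by
  rw [card_erase_of_mem (mem_univ i), card_univ]

theorem card_traces_le_pow [Fintype Φ] (S : Finset (ι × Φ)) :
    #(traces S) ≤ (#S + Fintype.card ι) ^ Fintype.card ι / Fintype.card ι ^ Fintype.card ι := by
  refine (card_traces_le S).trans ((prod_le_sum_pow_div univ _).trans_eq ?_)
  rw [sum_add_distrib, sum_card_charsAt, sum_const, smul_eq_mul, mul_one, card_univ]

variable [DecidableEq Φ]

theorem sum_erase_card_charsAt (S : Finset (ι × Φ)) (i : ι) :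
    ∑ i' ∈ univ.erase i, #(charsAt S i') = #(S \ charsAt S i) := by
  have hsum := add_sum_erase univ (fun i' => #(charsAt S i')) (mem_univ i)
  rw [sum_card_charsAt] at hsum
  have hsdiff := card_sdiff_add_card_eq_card (s := charsAt S i) (filter_subset _ S)
  omega

variable [Fintype Φ]

theorem card_traces_le_mul_pow (S : Finset (ι × Φ)) (i : ι) :
    #(traces S) ≤ (#(charsAt S i) + 1) * ((#(S \ charsAt S i) + (Fintype.card ι - 1)) ^
      (Fintype.card ι - 1) / (Fintype.card ι - 1) ^ (Fintype.card ι - 1)) := by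
  refine (card_traces_le S).trans ?_
  rw [← mul_prod_erase univ _ (mem_univ i)]
  refine Nat.mul_le_mul_left _ ((prod_le_sum_pow_div _ _).trans_eq ?_)
  rw [sum_add_distrib, sum_erase_card_charsAt, sum_const, smul_eq_mul, mul_one, card_erase_univ]

theorem card_diffs_erase_le {S e : Finset (ι × Φ)} {i : ι} (hι : Fintype.card ι ≤ 4)
    (hS : #(S \ charsAt S i) ≤ 70) (he : e ∈ powersetCard 2 (charsAt S i)) :
    #((diffs S).erase e) ≤
      pairCount #(charsAt S i) * pairBound (Fintype.card ι - 1) #(S \ charsAt S i) - 2 := by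
  have hmem : e ∈ diffs S := by
    obtain ⟨hsubset, hcard⟩ := mem_powersetCard.1 he
    obtain ⟨α, β, hne, rfl⟩ := card_eq_two.1 hcard
    obtain ⟨hα, hαi⟩ := mem_charsAt.1 (hsubset (mem_insert_self α {β}))
    obtain ⟨hβ, hβi⟩ := mem_charsAt.1 (hsubset (mem_insert_of_mem (mem_singleton_self β)))
    exact mem_diffs.2 (isDiff_pair hα hβ hne (hαi.trans hβi.symm))
  have hother : ∏ i' ∈ univ.erase i, pairCount #(charsAt S i') ≤
      pairBound (Fintype.card ι - 1) #(S \ charsAt S i) := by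
    rw [← sum_erase_card_charsAt, ← card_erase_univ i]
    refine prod_pairCount_le _ _ ?_ ?_
    · rw [card_erase_univ]
      omega
    · rwa [sum_erase_card_charsAt]
  have hlt := card_diffs_lt S
  rw [← mul_prod_erase univ _ (mem_univ i)] at hlt
  have hbound := hlt.trans_le (Nat.mul_le_mul_left (pairCount #(charsAt S i)) hother)
  rw [card_erase_of_mem hmem]
  omega

end CharacterCounts

/-- An upper bound for the number of families of `r` relations in `d` output positions that come
from at most `k` traces, if there are at most `K` traces. -/
def traceBound (d k K r : ℕ) : ℕ :=
  binomialBound (max K k) k * binomialBound (d * (k * (k - 1) / 2)) r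

theorem card_tracedFamilies_le_traceBound {ι Φ D : Type*} [Fintype ι] [DecidableEq ι] [Fintype Φ]
    [DecidableEq Φ] [Fintype D] {k r K : ℕ} {S : Finset (ι × Φ)} {T : Finset (Finset (ι × Φ))}
    (hT : ∅ ∉ T) (hK : #(traces S) ≤ K) :
    #(tracedFamilies D k r S T) ≤ traceBound (Fintype.card D) k K r := by
  refine (card_tracedFamilies_le_choose_mul_choose k r S hT).trans (Nat.mul_le_mul ?_ ?_)
  · exact choose_le_binomialBound (max_le_max_right k hK) k
  · exact choose_le_binomialBound (Nat.mul_le_mul_left _ (Nat.choose_two_right k).le) r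

/-- The parameters of a simple tabulation function and of the union bound for it. -/
structure Scheme where
  /-- The number of key characters. -/
  c : ℕ
  /-- The number of output characters. -/
  d : ℕ
  /-- The number of keys. -/
  k : ℕ
  /-- The number of bits of a key character. -/
  keyBits : ℕ
  /-- The number of bits of an output character. -/
  outBits : ℕ
  /-- The number of agreements of two characters that is unlikely by itself. -/
  many : ℕ
  /-- The largest number of characters that is counted separately for the position of the pair. -/
  cut : ℕ
  /-- The smallest weight of a character in the position of the pair, in hundredths. -/
  base : ℕ
  /-- The smallest weight of any character, in hundredths. -/
  slope : ℕ

namespace Scheme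

variable (A : Scheme)

/-- The weight, in hundredths, of the characters in the position of a pair with `p` agreements. Two
such characters weigh more than `p`, which forces a relation besides the `p` agreements. -/
def weight (p : ℕ) : ℕ := max A.base (50 * p + 1)

/-- The weight, in hundredths, of the characters outside the position of a pair with `p`
agreements. The average weight of a key is at most half of the number of output characters. -/
def otherWeight (p : ℕ) : ℕ := (50 * A.d - A.weight p) / (A.c - 1)

/-- The parameters admit the union bound. -/
structure Valid : Prop where
  d_pos : 0 < A.d
  c_le : A.c ≤ 4
  cut_le : A.cut ≤ 70
  two_le_k : 2 ≤ A.k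
  k_le : A.k ≤ 2 ^ A.keyBits
  weights : ∀ p < A.many, A.slope ≤ A.weight p ∧ A.slope ≤ A.otherWeight p ∧ A.weight p ≤ 50 * A.d

/-- The number of relations among `n` characters that the smallest weight guarantees. -/
def levelRank (n : ℕ) : ℕ := A.slope * n ⌈/⌉ 100

/-- The number of relations that the weights guarantee in addition to `p` agreements. -/
def forcedRank (p a s : ℕ) : ℕ := (A.weight p * a + A.otherWeight p * s) ⌈/⌉ 100 - p

section Certificates

variable {A} {Φ : Type*} [Fintype Φ] [DecidableEq Φ]

theorem Valid.exists_certified (hA : A.Valid) {R : Type*} [AddCommGroup R] [Module (ZMod 2) R]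
    {H : Fin A.c × Φ → Fin A.d → R} {X : Finset (Fin A.c → Φ)} (hne : X.Nonempty)
    (hk : #X ≤ A.k) (hX : ¬HasUniqueOutputChar (hashSum H) X) :
    Certified A.k H (pairCertificates (Fin A.c) Φ (Fin A.d) A.many) A.many ∨
    (∃ n ∈ Icc (A.cut + 1) (A.k * A.c), Certified A.k H
      (levelCertificates (Fin A.c) Φ (Fin A.d) A.k n (A.levelRank n)) (A.levelRank n)) ∨
    ∃ p ∈ range A.many, ∃ a ∈ Icc 2 A.cut, ∃ s ∈ range (A.cut - a + 1), Certified A.k H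
      (forcedCertificates (Fin A.c) Φ (Fin A.d) A.k p a s (A.forcedRank p a s))
      (A.forcedRank p a s + p) := by
  obtain ⟨ρ, α, β, hαβ, hpos, hsystem⟩ := exists_isCollisionSystem hA.d_pos hk hne hX
  set p := #(agreements H α β) with hp
  rcases le_or_gt A.many p with hmany | hfew
  · exact .inl (certified_pairCertificates hαβ hpos hA.two_le_k hmany)
  obtain ⟨hslope, hslope', hhalf⟩ := hA.weights p hfew
  have hweights : 2 * (A.weight p + (Fintype.card (Fin A.c) - 1) * A.otherWeight p) ≤
      100 * A.d := by
    have := Nat.mul_div_le (50 * A.d - A.weight p) (A.c - 1)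
    rw [Fintype.card_fin, otherWeight]
    omega
  obtain ⟨S, E, hSE, hα, hβ, hE⟩ := hsystem _ _ _ hweights
  have hsplit := card_sdiff_add_card_eq_card (s := charsAt S α.1) (filter_subset _ S)
  have hpair := card_le_card (mem_powersetCard.1
    (pair_mem_powersetCard_charsAt hα hβ hαβ hpos)).1
  rw [card_pair hαβ] at hpair
  rcases lt_or_ge A.cut #S with hcut | hcut
  · refine .inr (.inl ⟨#S, mem_Icc.2 ⟨hcut, ?_⟩, hSE.certified_levelCertificates ?_⟩)
    · rw [← sum_card_charsAt, mul_comm]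
      simpa using sum_le_card_nsmul univ _ _ fun i _ => hSE.card_charsAt_le i
    · rw [levelRank, ceilDiv_le_iff_le_mul (by norm_num), ← hsplit, mul_add, add_comm]
      exact (Nat.add_le_add (Nat.mul_le_mul_right _ hslope)
        (Nat.mul_le_mul_right _ hslope')).trans hE
  · have hrank : (A.weight p * #(charsAt S α.1) + A.otherWeight p * #(S \ charsAt S α.1)) ⌈/⌉ 100 ≤
        #E := (ceilDiv_le_iff_le_mul (by norm_num)).2 hE
    have hagree : (50 * p + 1) * 2 ≤ A.weight p * #(charsAt S α.1) :=
      Nat.mul_le_mul (le_max_right _ _) hpair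
    refine .inr (.inr ⟨p, mem_range.2 hfew, _, mem_Icc.2 ⟨hpair, by omega⟩, _,
      mem_range.2 (by omega), hSE.certified_forcedCertificates hα hβ hαβ hpos ?_⟩)
    rw [forcedRank, ← hp]
    omega

variable (A) in
/-- An upper bound for the number of pair certificates. -/
def pairTerm : ℕ := A.c * (binomialBound (2 ^ A.keyBits) 2 * binomialBound A.d A.many)

variable (A) in
/-- An upper bound for the number of level certificates for `n` characters. -/
def levelTerm (n : ℕ) : ℕ :=
  binomialBound (A.c * 2 ^ A.keyBits) n *
    traceBound A.d A.k ((n + A.c) ^ A.c / A.c ^ A.c) (A.levelRank n)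

variable (A) in
/-- An upper bound for the number of forced certificates for `p` agreements and `a + s`
characters. -/
def forcedTerm (p a s : ℕ) : ℕ :=
  A.c * (binomialBound (2 ^ A.keyBits) a * binomialBound ((A.c - 1) * 2 ^ A.keyBits) s *
    (a * (a - 1) / 2 * (binomialBound A.d p * min
      (binomialBound (A.d * (pairCount a * pairBound (A.c - 1) s - 2)) (A.forcedRank p a s))
      (traceBound A.d A.k ((a + 1) * ((s + (A.c - 1)) ^ (A.c - 1) / (A.c - 1) ^ (A.c - 1)))
        (A.forcedRank p a s)))))

variable (hΦ : Fintype.card Φ = 2 ^ A.keyBits)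
include hΦ

theorem card_pairCertificates_le_pairTerm :
    #(pairCertificates (Fin A.c) Φ (Fin A.d) A.many) ≤ A.pairTerm := by
  refine (card_pairCertificates_le _).trans ?_
  rw [Fintype.card_fin, Fintype.card_fin, pairTerm]
  gcongr
  exacts [choose_le_binomialBound hΦ.le 2, choose_le_binomialBound le_rfl _]

theorem card_levelCertificates_le_levelTerm (n : ℕ) :
    #(levelCertificates (Fin A.c) Φ (Fin A.d) A.k n (A.levelRank n)) ≤ A.levelTerm n := by
  have hfamilies : ∀ S : Finset (Fin A.c × Φ), #S = n →
      #(tracedFamilies (Fin A.d) A.k (A.levelRank n) S (diffs S)) ≤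
        traceBound A.d A.k ((n + A.c) ^ A.c / A.c ^ A.c) (A.levelRank n) := by
    rintro S rfl
    have htraces := card_traces_le_pow S
    rw [Fintype.card_fin] at htraces
    exact (card_tracedFamilies_le_traceBound (empty_notMem_diffs S) htraces).trans_eq
      (by rw [Fintype.card_fin])
  refine (card_levelCertificates_le hfamilies).trans (Nat.mul_le_mul_right _ ?_)
  rw [Fintype.card_fin, hΦ]
  exact choose_le_binomialBound le_rfl n

theorem Valid.card_forcedCertificates_le_forcedTerm (hA : A.Valid) {p a s : ℕ}
    (hs : s ≤ A.cut) :
    #(forcedCertificates (Fin A.c) Φ (Fin A.d) A.k p a s (A.forcedRank p a s)) ≤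
      A.forcedTerm p a s := by
  have hfamilies : ∀ (i : Fin A.c) (S e : Finset (Fin A.c × Φ)), #(charsAt S i) = a →
      #(S \ charsAt S i) = s → e ∈ powersetCard 2 (charsAt S i) →
      #(tracedFamilies (Fin A.d) A.k (A.forcedRank p a s) S ((diffs S).erase e)) ≤ min
        (binomialBound (A.d * (pairCount a * pairBound (A.c - 1) s - 2)) (A.forcedRank p a s))
        (traceBound A.d A.k ((a + 1) * ((s + (A.c - 1)) ^ (A.c - 1) / (A.c - 1) ^ (A.c - 1)))
          (A.forcedRank p a s)) := by
    rintro i S e rfl rfl he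
    have hdiffs := card_diffs_erase_le ((Fintype.card_fin A.c).trans_le hA.c_le)
      (hs.trans hA.cut_le) he
    have htraces := card_traces_le_mul_pow S i
    rw [Fintype.card_fin] at hdiffs htraces
    refine le_min ((card_tracedFamilies_le_choose _ _ S _).trans ?_) ?_
    · rw [Fintype.card_fin]
      exact choose_le_binomialBound (Nat.mul_le_mul_left _ hdiffs) _
    · refine (card_tracedFamilies_le_traceBound (fun h => ?_) htraces).trans_eq ?_
      · exact empty_notMem_diffs S (mem_of_mem_erase h)
      · rw [Fintype.card_fin]
  refine (card_forcedCertificates_le hfamilies).trans ?_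
  rw [Fintype.card_fin, Fintype.card_fin, hΦ, Nat.choose_two_right, forcedTerm]
  gcongr <;> exact choose_le_binomialBound le_rfl _

end Certificates

/-- An integer upper bound for `2 ^ 200` times the quotient `M / 2 ^ b`. -/
def scaled (M b : ℕ) : ℕ := M * 2 ^ 200 / 2 ^ b + 1

/-- An upper bound for `2 ^ 200` times the probability that the tabulation function of the scheme
is not `k`-unique. -/
def total : ℕ :=
  scaled A.pairTerm (A.outBits * A.many) +
  ((∑ n ∈ Icc (A.cut + 1) (A.k * A.c), scaled (A.levelTerm n) (A.outBits * A.levelRank n)) +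
  ∑ p ∈ range A.many, ∑ a ∈ Icc 2 A.cut, ∑ s ∈ range (A.cut - a + 1),
    scaled (A.forcedTerm p a s) (A.outBits * (A.forcedRank p a s + p)))

section Probability

variable {A} {Ω Φ : Type*} [MeasurableSpace Ω] {μ : Measure Ω} [Fintype Φ]

theorem measureReal_certified_le [DecidableEq Φ] {c d k s : ℕ}
    {h : Fin c → Ω → Φ → Fin d → XorBits s}
    (hh : AreRandomTables k μ h) (hk : k ≤ Fintype.card Φ)
    {C : Finset (Finset (Fin d × Finset (Fin c × Φ)))} {r M : ℕ} (hM : #C ≤ M) :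
    μ.real {ω | Certified k (fun α => h α.1 ω α.2) C r} ≤ scaled M (s * r) / 2 ^ 200 := by
  have hmeasure : μ.real {ω | Certified k (fun α => h α.1 ω α.2) C r} ≤
      #C * (2 ^ (s * r) : ℝ)⁻¹ := by
    have htop : #C * (Fintype.card (XorBits s) : ENNReal)⁻¹ ^ r ≠ ⊤ :=
      ENNReal.mul_ne_top (ENNReal.natCast_ne_top _) (ENNReal.pow_ne_top
        (ENNReal.inv_ne_top.2 (Nat.cast_ne_zero.2 Fintype.card_ne_zero)))
    simpa [Measure.real, XorBits.card_eq, pow_mul] using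
      ENNReal.toReal_mono htop (hh.measure_certified_le hk C r)
  have hscaled : (M : ℝ) * 2 ^ 200 ≤ scaled M (s * r) * 2 ^ (s * r) := by
    rw [mul_comm (scaled M (s * r) : ℝ)]
    exact_mod_cast (Nat.lt_mul_div_succ _ (by positivity)).le
  calc μ.real {ω | Certified k (fun α => h α.1 ω α.2) C r}
      ≤ #C * (2 ^ (s * r) : ℝ)⁻¹ := hmeasure
    _ ≤ M * (2 ^ (s * r) : ℝ)⁻¹ := by gcongr
    _ ≤ scaled M (s * r) / 2 ^ 200 := by
        rwa [← div_eq_mul_inv, div_le_div_iff₀ (by positivity) (by positivity)]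

variable [IsProbabilityMeasure μ]

theorem Valid.measureReal_not_isKUnique_le (hA : A.Valid)
    (hΦ : Fintype.card Φ = 2 ^ A.keyBits) {h : Fin A.c → Ω → Φ → Fin A.d → BitVec A.outBits}
    (hh : AreRandomTables A.k μ h) :
    μ.real {ω | ¬IsKUnique A.k (simpleTabulation fun i => h i ω)} ≤ A.total / 2 ^ 200 := by
  classical
  let tables (ω : Ω) (α : Fin A.c × Φ) (j : Fin A.d) : XorBits A.outBits := h α.1 ω α.2 j
  have hcover : {ω | ¬IsKUnique A.k (simpleTabulation fun i => h i ω)} ⊆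
      {ω | Certified A.k (tables ω) (pairCertificates (Fin A.c) Φ (Fin A.d) A.many) A.many} ∪
      ((⋃ n ∈ Icc (A.cut + 1) (A.k * A.c), {ω | Certified A.k (tables ω)
        (levelCertificates (Fin A.c) Φ (Fin A.d) A.k n (A.levelRank n)) (A.levelRank n)}) ∪
      ⋃ p ∈ range A.many, ⋃ a ∈ Icc 2 A.cut, ⋃ s ∈ range (A.cut - a + 1),
        {ω | Certified A.k (tables ω)
          (forcedCertificates (Fin A.c) Φ (Fin A.d) A.k p a s (A.forcedRank p a s))
          (A.forcedRank p a s + p)}) := fun ω hω => by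
    have htabulation : simpleTabulation (fun i => h i ω) = hashSum (tables ω) :=
      funext₂ fun x j => XorBits.fold_xor_eq_sum univ fun i => tables ω (i, x i) j
    simp only [Set.mem_ofPred_eq, IsKUnique, not_forall, htabulation] at hω
    obtain ⟨X, hne, hk, hX⟩ := hω
    simpa only [Set.mem_union, Set.mem_iUnion, Set.mem_ofPred_eq, exists_prop] using
      hA.exists_certified hne hk hX
  have hk : A.k ≤ Fintype.card Φ := hA.k_le.trans_eq hΦ.symm
  refine (measureReal_mono hcover).trans ((measureReal_union_le _ _).trans ?_)
  rw [total]
  push_cast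
  simp only [add_div, sum_div]
  refine add_le_add ?_ ((measureReal_union_le _ _).trans (add_le_add ?_ ?_))
  · exact measureReal_certified_le hh hk (card_pairCertificates_le_pairTerm hΦ)
  · refine (measureReal_biUnion_finset_le _ _).trans (sum_le_sum fun n _ => ?_)
    exact measureReal_certified_le hh hk (card_levelCertificates_le_levelTerm hΦ n)
  · refine (measureReal_biUnion_finset_le _ _).trans (sum_le_sum fun p _ => ?_)
    refine (measureReal_biUnion_finset_le _ _).trans (sum_le_sum fun a _ => ?_)
    refine (measureReal_biUnion_finset_le _ _).trans (sum_le_sum fun s hs => ?_)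
    have ha : s ≤ A.cut := by
      rw [mem_range] at hs
      omega
    exact measureReal_certified_le hh hk (hA.card_forcedCertificates_le_forcedTerm hΦ ha)

theorem Valid.measureReal_not_isKUnique_le_of_total_le (hA : A.Valid) {N e : ℕ}
    (htotal : A.total * 10 ^ e ≤ N * 2 ^ 200)
    {h : Fin A.c → Ω → BitVec A.keyBits → Fin A.d → BitVec A.outBits}
    (hh : AreRandomTables A.k μ h) :
    μ.real {ω | ¬IsKUnique A.k (simpleTabulation fun i => h i ω)} ≤ N / 10 ^ e := by
  have hΦ : Fintype.card (BitVec A.keyBits) = 2 ^ A.keyBits := XorBits.card_eq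
  refine (hA.measureReal_not_isKUnique_le hΦ hh).trans ?_
  rw [div_le_div_iff₀ (by positivity) (by positivity)]
  exact_mod_cast htotal

end Probability

/-- 32-bit keys with 20 output characters of 16 bits. -/
def twoCharacters : Scheme where
  c := 2
  d := 20
  k := 100
  keyBits := 16
  outBits := 16
  many := 12
  cut := 45
  base := 502
  slope := 448

/-- 64-bit keys with 24 output characters of 22 bits. -/
def threeCharacters : Scheme where
  c := 3
  d := 24
  k := 100
  keyBits := 22
  outBits := 22
  many := 11
  cut := 45
  base := 402
  slope := 349

/-- 64-bit keys with 14 output characters of 32 bits. -/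
def fourCharacters : Scheme where
  c := 4
  d := 14
  k := 100
  keyBits := 16
  outBits := 32
  many := 6
  cut := 70
  base := 175
  slope := 149

theorem valid_twoCharacters : twoCharacters.Valid := by
  constructor <;> decide +kernel

theorem valid_threeCharacters : threeCharacters.Valid := by
  constructor <;> decide +kernel

theorem valid_fourCharacters : fourCharacters.Valid := by
  constructor <;> decide +kernel

theorem total_twoCharacters_le : twoCharacters.total * 10 ^ 43 ≤ 15 * 2 ^ 200 := by
  decide +kernel

theorem total_threeCharacters_le : threeCharacters.total * 10 ^ 50 ≤ 14 * 2 ^ 200 := by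
  decide +kernel

theorem total_fourCharacters_le : fourCharacters.total * 10 ^ 36 ≤ 9 * 2 ^ 200 := by
  decide +kernel

end Scheme

end Tabulation

theorem theorem6 {Ω : Type*} [MeasurableSpace Ω] (μ : Measure Ω) [IsProbabilityMeasure μ] :
    (∀ h : Fin 2 → Ω → BitVec 16 → Fin 20 → BitVec 16, Tabulation.AreRandomTables 100 μ h →
      μ.real {ω | ¬ Tabulation.IsKUnique 100 (Tabulation.simpleTabulation fun i => h i ω)}
        ≤ 1.5 * (10 : ℝ) ^ (-42 : ℤ)) ∧
    (∀ h : Fin 3 → Ω → BitVec 22 → Fin 24 → BitVec 22, Tabulation.AreRandomTables 100 μ h →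
      μ.real {ω | ¬ Tabulation.IsKUnique 100 (Tabulation.simpleTabulation fun i => h i ω)}
        ≤ 1.4 * (10 : ℝ) ^ (-49 : ℤ)) ∧
    (∀ h : Fin 4 → Ω → BitVec 16 → Fin 14 → BitVec 32, Tabulation.AreRandomTables 100 μ h →
      μ.real {ω | ¬ Tabulation.IsKUnique 100 (Tabulation.simpleTabulation fun i => h i ω)}
        ≤ 9.0 * (10 : ℝ) ^ (-36 : ℤ)) := by
  open Tabulation.Scheme in
  refine ⟨fun h hh => ?_, fun h hh => ?_, fun h hh => ?_⟩
  · exact (valid_twoCharacters.measureReal_not_isKUnique_le_of_total_le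
      total_twoCharacters_le hh).trans (by norm_num)
  · exact (valid_threeCharacters.measureReal_not_isKUnique_le_of_total_le
      total_threeCharacters_le hh).trans (by norm_num)
  · exact (valid_fourCharacters.measureReal_not_isKUnique_le_of_total_le
      total_fourCharacters_le hh).trans (by norm_num)
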